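/- Let $q\in\mathbb R$ with $q\neq 0,\pm1$, and let $c\in\mathbb R$, $c\ne 0$. Let $U_q(\mathfrak{sl}_2)$ be the complex Hopf algebra generated by $E,F,K^{\pm1}$ with $KE=q^2EK$, $KF=q^{-2}FK$, $EF-FE=\frac{K-K^{-1}}{q-q^{-1}}$, $\Delta E=E\otimes K+1\otimes E$, $\Delta F=F\otimes 1+K^{-1}\otimes F$, $\Delta K=K\otimes K$, $S(E)=-EK^{-1}$, $S(F)=-KF$, $S(K)=K^{-1}$, acting on itself by $\mathrm{ad}_a b=\sum a_{(1)}bS(a_{(2)})$. Let $V_{2\pi}$ be the $U_q(\mathfrak{sl}_2)$-module with basis $v_2,v_0,v_{-2}$, $Kv_i=q^iv_i$, and $Ev_2=0$, $Ev_0=-(q+q^{-1})v_2$, $Ev_{-2}=v_0$, $Fv_2=-v_0$, $Fv_0=(q+q^{-1})v_{-2}$, $Fv_{-2}=0$, with the invariant form $\langle v_2,v_{-2}\rangle=c$, $\langle v_0,v_0\rangle=q^{-3}(1+q^2)c$, $\langle v_{-2},v_2\rangle=q^{-2}c$ (all other values $0$). Let $$\mathcal R=q^{H\otimes H/2}\sum_{m\ge0}\frac{q^{m(m-1)/2}(q-q^{-1})^m}{[m]_q!}E^m\otimes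 F^m ,\qquad K=q^H,\quad [m]_q=\frac{q^m-q^{-m}}{q-q^{-1}},$$ be the universal $R$-matrix, $\tau$ the flip, $\sigma_{\mathcal R}=\tau\circ\mathcal R$, and let $\tilde\sigma=\sigma_{\mathcal R}\circ \mathcal D^{-1}$ be the normalised braiding of $V_{2\pi}\otimes V_{2\pi}$, where $\mathcal D$ is the square root of $\mathcal R_{21}\mathcal R$ with positive eigenvalues. The $q$-deformed Clifford algebra is the module algebra $$\mathrm{Cl}_q(\mathfrak{sl}_2)=T(V_{2\pi})/\langle x\otimes y+\tilde\sigma(x\otimes y)-2\langle x,y\rangle 1\rangle .$$ Let $\mathcal W_q^-=U_q(\mathfrak{sl}_2)\otimes_{\mathcal R}\mathrm{Cl}_q(\mathfrak{sl}_2)$ and $\mathcal W_q^+=U_q(\mathfrak{sl}_2)\otimes_{\mathcal R_{21}^{-1}}\mathrm{Cl}_q(\mathfrak{sl}_2)$ be the braided tensor products, i.e. the space $U_q(\mathfrak{sl}_2)\otimes \mathrm{Cl}_q(\mathfrak{sl}_2)$ with product $(m\otimes m)\circ(\mathrm{id}\otimes\sigma\otimes\mathrm{id})$ for $\sigma=\tau\circ\mathcal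 R$ and $\sigma=\tau\circ\mathcal R_{21}^{-1}$, respectively. With $X=E$, $Z=q^{-2}EF-FE$, $Y=KF$, $C=EF+\frac{q^{-1}K+qK^{-1}}{(q-q^{-1})^2}$ and $\gamma=v_2v_0v_{-2}+cv_0$, put $$D_q^-=\frac1c\Bigl(X\otimes v_{-2}+\frac{q}{1+q^2}Z\otimes v_0+q^{-2}Y\otimes v_2\Bigr)-\frac{(q^2-1)^2}{2q(q^2+1)c^2}\,C\otimes\gamma\in\mathcal W_q^-,$$ $$D_q^+=\frac{q^4}c\Bigl(X\otimes v_{-2}+\frac{q}{1+q^2}Z\otimes v_0+q^{-2}Y\otimes v_2\Bigr)-\frac{(q^2-1)^2}{2q(q^2+1)c^2}\,C\otimes\gamma\in\mathcal W_q^+ .$$ For a sign $\varepsilon=1$ (real form $\mathfrak{su}_2$) or $\varepsilon=-1$ (real form $\mathfrak{su}_{1,1}$), let $*$ be the antilinear anti-multiplicative maps of $U_q(\mathfrak{sl}_2)$ and of $\mathrm{Cl}_q(\mathfrak{sl}_2)$ with $E^*=\varepsilon FK$, $F^*=\varepsilon K^{-1}E$, $K^*=K$, and $v_2^*=\varepsilon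 q^2v_{-2}$, $v_0^*=v_0$, $v_{-2}^*=\varepsilon q^{-2}v_2$, and define antilinear maps $$*:\mathcal W_q^-\to\mathcal W_q^+,\ (a\otimes b)^*=\tau\bigl(\mathcal R_{21}^{-1}(b^*\otimes a^*)\bigr),\qquad *:\mathcal W_q^+\to\mathcal W_q^-,\ (a\otimes b)^*=\tau\bigl(\mathcal R(b^*\otimes a^*)\bigr).$$ **Theorem.** For both real forms, $(D_q^-)^*=D_q^+$ and $(D_q^+)^*=D_q^-$. -/

import Mathlib

open scoped TensorProduct ComplexConjugate

set_option linter.unusedSectionVars false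
set_option linter.unusedSimpArgs false

noncomputable section
namespace QWeil

/-! ## The quantum group -/

/-- Names of the generators of `U_q(sl_2)`. -/
inductive UqGen
  | E | F | K | Kinv

/-- The defining relations of `U_q(sl_2)`. -/
inductive UqRel (q : ℝ) : FreeAlgebra ℂ UqGen → FreeAlgebra ℂ UqGen → Prop
  | KE : UqRel q (FreeAlgebra.ι ℂ UqGen.K * FreeAlgebra.ι ℂ UqGen.E)
      ((q : ℂ) ^ 2 • (FreeAlgebra.ι ℂ UqGen.E * FreeAlgebra.ι ℂ UqGen.K))
  | KF : UqRel q (FreeAlgebra.ι ℂ UqGen.K * FreeAlgebra.ι ℂ UqGen.F)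
      (((q : ℂ) ^ 2)⁻¹ • (FreeAlgebra.ι ℂ UqGen.F * FreeAlgebra.ι ℂ UqGen.K))
  | KKinv : UqRel q (FreeAlgebra.ι ℂ UqGen.K * FreeAlgebra.ι ℂ UqGen.Kinv) 1
  | KinvK : UqRel q (FreeAlgebra.ι ℂ UqGen.Kinv * FreeAlgebra.ι ℂ UqGen.K) 1
  | EF : UqRel q
      (FreeAlgebra.ι ℂ UqGen.E * FreeAlgebra.ι ℂ UqGen.F
        - FreeAlgebra.ι ℂ UqGen.F * FreeAlgebra.ι ℂ UqGen.E)
      (((q : ℂ) - (q : ℂ)⁻¹)⁻¹ • (FreeAlgebra.ι ℂ UqGen.K - FreeAlgebra.ι ℂ UqGen.Kinv))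

/-- The algebra `U_q(sl_2)` over `ℂ`, presented by generators and relations. -/
def Uq (q : ℝ) : Type := RingQuot (UqRel q)

instance (q : ℝ) : Ring (Uq q) := inferInstanceAs (Ring (RingQuot (UqRel q)))
instance (q : ℝ) : Algebra ℂ (Uq q) := inferInstanceAs (Algebra ℂ (RingQuot (UqRel q)))

namespace Uq

/-- The image of a generator in `U_q(sl_2)`. -/
def gen (q : ℝ) (g : UqGen) : Uq q := RingQuot.mkAlgHom ℂ (UqRel q) (FreeAlgebra.ι ℂ g)

/-- The generator `E`. -/
def E (q : ℝ) : Uq q := gen q UqGen.E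
/-- The generator `F`. -/
def F (q : ℝ) : Uq q := gen q UqGen.F
/-- The generator `K`. -/
def K (q : ℝ) : Uq q := gen q UqGen.K
/-- The generator `K⁻¹`. -/
def Kinv (q : ℝ) : Uq q := gen q UqGen.Kinv

theorem K_mul_E (q : ℝ) : K q * E q = (q : ℂ) ^ 2 • (E q * K q) := by
  have h := RingQuot.mkAlgHom_rel ℂ (UqRel.KE (q := q))
  simp only [map_mul, map_smul] at h
  exact h

theorem K_mul_F (q : ℝ) : K q * F q = ((q : ℂ) ^ 2)⁻¹ • (F q * K q) := by
  have h := RingQuot.mkAlgHom_rel ℂ (UqRel.KF (q := q))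
  simp only [map_mul, map_smul] at h
  exact h

theorem K_mul_Kinv (q : ℝ) : K q * Kinv q = 1 := by
  have h := RingQuot.mkAlgHom_rel ℂ (UqRel.KKinv (q := q))
  simp only [map_mul, map_one] at h
  exact h

theorem Kinv_mul_K (q : ℝ) : Kinv q * K q = 1 := by
  have h := RingQuot.mkAlgHom_rel ℂ (UqRel.KinvK (q := q))
  simp only [map_mul, map_one] at h
  exact h

theorem E_F_comm (q : ℝ) :
    E q * F q - F q * E q = ((q : ℂ) - (q : ℂ)⁻¹)⁻¹ • (K q - Kinv q) := by
  have h := RingQuot.mkAlgHom_rel ℂ (UqRel.EF (q := q))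
  simp only [map_mul, map_sub, map_smul] at h
  exact h

/-- `K` as a unit, so that `K ^ i` makes sense for all integers `i`. -/
def Kunit (q : ℝ) : (Uq q)ˣ := ⟨K q, Kinv q, K_mul_Kinv q, Kinv_mul_K q⟩

/-- The universal property of the presentation. -/
def lift {q : ℝ} {A : Type*} [Ring A] [Algebra ℂ A] (e f k k' : A)
    (hke : k * e = (q : ℂ) ^ 2 • (e * k)) (hkf : k * f = ((q : ℂ) ^ 2)⁻¹ • (f * k))
    (hkk' : k * k' = 1) (hk'k : k' * k = 1)
    (hef : e * f - f * e = ((q : ℂ) - (q : ℂ)⁻¹)⁻¹ • (k - k')) : Uq q →ₐ[ℂ] A :=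
  RingQuot.liftAlgHom ℂ ⟨FreeAlgebra.lift ℂ (fun g => match g with
    | UqGen.E => e | UqGen.F => f | UqGen.K => k | UqGen.Kinv => k'), by
      intro x y h
      cases h <;> simp [*]⟩

section lift
variable {q : ℝ} {A : Type*} [Ring A] [Algebra ℂ A] (e f k k' : A)
    (hke : k * e = (q : ℂ) ^ 2 • (e * k)) (hkf : k * f = ((q : ℂ) ^ 2)⁻¹ • (f * k))
    (hkk' : k * k' = 1) (hk'k : k' * k = 1)
    (hef : e * f - f * e = ((q : ℂ) - (q : ℂ)⁻¹)⁻¹ • (k - k'))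

@[simp] theorem lift_E : lift e f k k' hke hkf hkk' hk'k hef (E q) = e :=
  (RingQuot.liftAlgHom_mkAlgHom_apply ℂ _ _ _).trans (by simp)
@[simp] theorem lift_F : lift e f k k' hke hkf hkk' hk'k hef (F q) = f :=
  (RingQuot.liftAlgHom_mkAlgHom_apply ℂ _ _ _).trans (by simp)
@[simp] theorem lift_K : lift e f k k' hke hkf hkk' hk'k hef (K q) = k :=
  (RingQuot.liftAlgHom_mkAlgHom_apply ℂ _ _ _).trans (by simp)
@[simp] theorem lift_Kinv : lift e f k k' hke hkf hkk' hk'k hef (Kinv q) = k' :=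
  (RingQuot.liftAlgHom_mkAlgHom_apply ℂ _ _ _).trans (by simp)
end lift

theorem E_mul_Kinv (q : ℝ) : E q * Kinv q = (q : ℂ) ^ 2 • (Kinv q * E q) := by
  calc E q * Kinv q = Kinv q * (K q * E q) * Kinv q := by
        rw [← mul_assoc, Kinv_mul_K, one_mul]
    _ = (q : ℂ) ^ 2 • (Kinv q * E q) := by
        rw [K_mul_E]
        simp [mul_assoc, K_mul_Kinv]

theorem F_mul_Kinv (q : ℝ) : F q * Kinv q = ((q : ℂ) ^ 2)⁻¹ • (Kinv q * F q) := by
  calc F q * Kinv q = Kinv q * (K q * F q) * Kinv q := by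
        rw [← mul_assoc, Kinv_mul_K, one_mul]
    _ = ((q : ℂ) ^ 2)⁻¹ • (Kinv q * F q) := by
        rw [K_mul_F]
        simp [mul_assoc, K_mul_Kinv]

variable (q : ℝ) [hq : Fact (q ≠ 0)]

theorem q_ne : (q : ℂ) ≠ 0 := by exact_mod_cast hq.out

/-- The coproduct: `Δ E = E ⊗ K + 1 ⊗ E`, `Δ F = F ⊗ 1 + K⁻¹ ⊗ F`, `Δ K = K ⊗ K`,
`Δ K⁻¹ = K⁻¹ ⊗ K⁻¹`. -/
def coprod : Uq q →ₐ[ℂ] Uq q ⊗[ℂ] Uq q :=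
  lift (E q ⊗ₜ K q + 1 ⊗ₜ E q) (F q ⊗ₜ 1 + Kinv q ⊗ₜ F q) (K q ⊗ₜ K q) (Kinv q ⊗ₜ Kinv q)
    (by
      simp only [mul_add, add_mul, Algebra.TensorProduct.tmul_mul_tmul, K_mul_E, mul_one, one_mul,
        TensorProduct.smul_tmul', TensorProduct.tmul_smul, smul_add])
    (by
      simp only [mul_add, add_mul, Algebra.TensorProduct.tmul_mul_tmul, K_mul_F, mul_one, one_mul,
        TensorProduct.smul_tmul', TensorProduct.tmul_smul, smul_add, K_mul_Kinv, Kinv_mul_K])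
    (by simp [Algebra.TensorProduct.one_def, K_mul_Kinv])
    (by simp [Algebra.TensorProduct.one_def, Kinv_mul_K])
    (by
      have hq0 := q_ne q
      have h1 : E q * F q = F q * E q + ((q : ℂ) - (q : ℂ)⁻¹)⁻¹ • (K q - Kinv q) := by
        rw [← E_F_comm]; abel
      simp only [mul_add, add_mul, Algebra.TensorProduct.tmul_mul_tmul, mul_one, one_mul, h1,
        K_mul_F, E_mul_Kinv, ← TensorProduct.smul_tmul', TensorProduct.tmul_smul,
        TensorProduct.add_tmul, TensorProduct.tmul_add, TensorProduct.sub_tmul,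
        TensorProduct.tmul_sub, smul_smul]
      rw [inv_mul_cancel₀ (pow_ne_zero 2 hq0)]
      module)

/-- The antipode, an algebra map to the opposite algebra: `S E = -E K⁻¹`, `S F = -K F`,
`S K = K⁻¹`, `S K⁻¹ = K`. -/
def antipode : Uq q →ₐ[ℂ] (Uq q)ᵐᵒᵖ :=
  lift (MulOpposite.op (-(E q * Kinv q))) (MulOpposite.op (-(K q * F q)))
    (MulOpposite.op (Kinv q)) (MulOpposite.op (K q))
    (by
      apply MulOpposite.unop_injective
      simp only [MulOpposite.unop_mul, MulOpposite.unop_op, MulOpposite.unop_smul, neg_mul, mul_neg]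
      rw [E_mul_Kinv, smul_mul_assoc, mul_smul_comm, mul_assoc, E_mul_Kinv, mul_smul_comm, smul_neg])
    (by
      apply MulOpposite.unop_injective
      simp only [MulOpposite.unop_mul, MulOpposite.unop_op, MulOpposite.unop_smul, neg_mul, mul_neg]
      rw [mul_assoc, F_mul_Kinv, mul_smul_comm, ← mul_assoc, ← mul_assoc, K_mul_Kinv, Kinv_mul_K,
        smul_neg])
    (by rw [← MulOpposite.op_mul, K_mul_Kinv, MulOpposite.op_one])
    (by rw [← MulOpposite.op_mul, Kinv_mul_K, MulOpposite.op_one])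
    (by
      apply MulOpposite.unop_injective
      have hq0 := q_ne q
      have h2 : K q * F q * (E q * Kinv q) = F q * E q := by
        rw [K_mul_F, E_mul_Kinv, smul_mul_smul_comm, inv_mul_cancel₀ (pow_ne_zero 2 hq0), one_smul,
          mul_assoc, ← mul_assoc (K q), K_mul_Kinv, one_mul]
      have h3 : E q * Kinv q * (K q * F q) = E q * F q := by
        rw [mul_assoc, ← mul_assoc (Kinv q), Kinv_mul_K, one_mul]
      simp only [MulOpposite.unop_mul, MulOpposite.unop_op, MulOpposite.unop_smul,
        MulOpposite.unop_sub, neg_mul_neg, h2, h3]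
      rw [← neg_sub, E_F_comm, ← smul_neg, neg_sub])

/-- The left adjoint action `ad_a b = ∑ a₍₁₎ b S(a₍₂₎)` of `U_q(sl_2)` on itself. -/
def ad : Uq q →ₐ[ℂ] Module.End ℂ (Uq q) :=
  (Algebra.TensorProduct.lift (Algebra.lmul ℂ (Uq q))
    ((AlgHom.mk' (R := ℂ) (A := (Uq q)ᵐᵒᵖ) (B := Module.End ℂ (Uq q))
      { toFun := fun s => LinearMap.mulRight ℂ s.unop
        map_one' := by ext; simp
        map_mul' := fun s t => by ext; simp [mul_assoc]
        map_zero' := by ext; simp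
        map_add' := fun s t => by ext; simp [mul_add] }
      (fun r s => by ext; simp)).comp (antipode q))
    (fun a b => by
      apply LinearMap.ext
      intro x
      simp [mul_assoc])).comp (coprod q)

theorem ad_E (b : Uq q) : ad q (E q) b = E q * b * Kinv q - b * (E q * Kinv q) := by
  simp [ad, coprod, antipode, sub_eq_add_neg, mul_assoc]
theorem ad_F (b : Uq q) : ad q (F q) b = F q * b - Kinv q * b * (K q * F q) := by
  simp [ad, coprod, antipode, sub_eq_add_neg, mul_assoc]
theorem ad_K (b : Uq q) : ad q (K q) b = K q * b * Kinv q := by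
  simp [ad, coprod, antipode, mul_assoc]

end Uq

/-! ## Antilinear anti-multiplicative maps and the real forms of `U_q(sl_2)` -/

/-- The opposite of a complex algebra, with complex conjugate scalar multiplication. An algebra
map `A → ConjOp A` is the same thing as an antilinear anti-multiplicative unital map `A → A`. -/
def ConjOp (A : Type*) : Type _ := Aᵐᵒᵖ

namespace ConjOp
variable {A : Type*}

/-- The identity map `A → ConjOp A`. -/
def mk (a : A) : ConjOp A := MulOpposite.op a
/-- The identity map `ConjOp A → A`. -/
def get (a : ConjOp A) : A := MulOpposite.unop a

variable [Ring A] [Algebra ℂ A]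

instance : Ring (ConjOp A) := inferInstanceAs (Ring Aᵐᵒᵖ)
instance : Algebra ℂ (ConjOp A) :=
  RingHom.toAlgebra' ((algebraMap ℂ Aᵐᵒᵖ).comp (starRingEnd ℂ))
    (fun z x => Algebra.commutes (A := Aᵐᵒᵖ) (conj z) x)

theorem get_injective : Function.Injective (get : ConjOp A → A) := MulOpposite.unop_injective
@[simp] theorem get_mk (a : A) : get (mk a) = a := rfl
@[simp] theorem get_mul (x y : ConjOp A) : get (x * y) = get y * get x := rfl
@[simp] theorem get_add (x y : ConjOp A) : get (x + y) = get x + get y := rfl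
@[simp] theorem get_neg (x : ConjOp A) : get (-x) = -get x := rfl
@[simp] theorem get_sub (x y : ConjOp A) : get (x - y) = get x - get y := rfl
@[simp] theorem get_one : get (1 : ConjOp A) = 1 := rfl
@[simp] theorem get_zero : get (0 : ConjOp A) = 0 := rfl
@[simp] theorem get_smul (z : ℂ) (x : ConjOp A) : get (z • x) = conj z • get x := by
  rw [Algebra.smul_def, Algebra.smul_def, get_mul, Algebra.commutes]
  rfl

/-- The antilinear map `A → A` underlying an algebra map `A → ConjOp A`. -/
def toStar (f : A →ₐ[ℂ] ConjOp A) : A →ₛₗ[starRingEnd ℂ] A where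
  toFun a := get (f a)
  map_add' a b := by simp
  map_smul' z a := by simp

end ConjOp

/-- The two real forms `U_q(su_2)` and `U_q(su_{1,1})` for real `q`. -/
inductive RealForm
  | su2 | su11

/-- The sign that distinguishes the two real forms. -/
def RealForm.sgn : RealForm → ℂ
  | su2 => 1
  | su11 => -1

theorem RealForm.sgn_mul_sgn (s : RealForm) : s.sgn * s.sgn = 1 := by
  cases s <;> simp [RealForm.sgn]
theorem RealForm.conj_sgn (s : RealForm) : conj s.sgn = s.sgn := by
  cases s <;> simp [RealForm.sgn]

namespace Uq
variable (q : ℝ) [hq : Fact (q ≠ 0)]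

/-- The star structure of `U_q(su_2)`, `E* = F K`, `F* = K⁻¹ E`, `K* = K`, and of `U_q(su_{1,1})`,
`E* = -F K`, `F* = -K⁻¹ E`, `K* = K`, as an algebra map to the conjugate opposite algebra. -/
def starHom (s : RealForm) : Uq q →ₐ[ℂ] ConjOp (Uq q) :=
  lift (ConjOp.mk (s.sgn • (F q * K q))) (ConjOp.mk (s.sgn • (Kinv q * E q)))
    (ConjOp.mk (K q)) (ConjOp.mk (Kinv q))
    (by
      apply ConjOp.get_injective
      have hq0 := q_ne q
      simp only [ConjOp.get_mul, ConjOp.get_mk, ConjOp.get_smul, smul_mul_assoc, mul_smul_comm,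
        map_pow, Complex.conj_ofReal]
      rw [← mul_assoc, K_mul_F, smul_mul_assoc, smul_comm s.sgn, smul_smul ((q : ℂ) ^ 2),
        mul_inv_cancel₀ (pow_ne_zero 2 hq0), one_smul])
    (by
      apply ConjOp.get_injective
      have hq0 := q_ne q
      simp only [ConjOp.get_mul, ConjOp.get_mk, ConjOp.get_smul, smul_mul_assoc, mul_smul_comm,
        map_pow, map_inv₀, Complex.conj_ofReal]
      rw [← mul_assoc (K q), K_mul_Kinv, one_mul, mul_assoc,
        show E q * K q = ((q : ℂ) ^ 2)⁻¹ • (K q * E q) by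
          rw [K_mul_E, smul_smul, inv_mul_cancel₀ (pow_ne_zero 2 hq0), one_smul],
        mul_smul_comm, ← mul_assoc, Kinv_mul_K, one_mul, smul_comm])
    (by apply ConjOp.get_injective; simp [Kinv_mul_K])
    (by apply ConjOp.get_injective; simp [K_mul_Kinv])
    (by
      apply ConjOp.get_injective
      have hq0 := q_ne q
      have h2 : F q * K q * (Kinv q * E q) = F q * E q := by
        rw [mul_assoc, ← mul_assoc (K q), K_mul_Kinv, one_mul]
      have h3 : Kinv q * E q * (F q * K q) = E q * F q := by
        rw [show F q * K q = (q : ℂ) ^ 2 • (K q * F q) by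
            rw [K_mul_F, smul_smul, mul_inv_cancel₀ (pow_ne_zero 2 hq0), one_smul],
          mul_smul_comm, ← smul_mul_assoc, ← E_mul_Kinv, mul_assoc, ← mul_assoc (Kinv q),
          Kinv_mul_K, one_mul]
      simp only [ConjOp.get_mul, ConjOp.get_mk, ConjOp.get_smul, ConjOp.get_sub, smul_mul_smul_comm,
        s.sgn_mul_sgn, one_smul, h2, h3, map_inv₀, map_sub, Complex.conj_ofReal]
      rw [E_F_comm])

/-- The star structure on `U_q(sl_2)` attached to a real form. -/
def star (s : RealForm) : Uq q →ₛₗ[starRingEnd ℂ] Uq q := ConjOp.toStar (starHom q s)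

theorem star_mul (s : RealForm) (a b : Uq q) : star q s (a * b) = star q s b * star q s a := by
  simp [star, ConjOp.toStar]
theorem star_E (s : RealForm) : star q s (E q) = s.sgn • (F q * K q) := by
  simp [star, ConjOp.toStar, starHom]
theorem star_F (s : RealForm) : star q s (F q) = s.sgn • (Kinv q * E q) := by
  simp [star, ConjOp.toStar, starHom]
theorem star_K (s : RealForm) : star q s (K q) = K q := by
  simp [star, ConjOp.toStar, starHom]

end Uq

/-! ## The `R`-matrix acting on tensor products of modules -/

/-- The space of vectors of weight `2 i` in a `U_q(sl_2)`-module: `K v = q ^ (2 i) v`. -/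
def wtSpace {q : ℝ} {M : Type*} [AddCommGroup M] [Module ℂ M] (ρ : Uq q →ₐ[ℂ] Module.End ℂ M)
    (i : ℤ) : Submodule ℂ M :=
  Module.End.eigenspace (ρ (Uq.K q)) ((q : ℂ) ^ (2 * i))

section RMatrix
variable {q : ℝ} {M N : Type*} [AddCommGroup M] [Module ℂ M] [AddCommGroup N] [Module ℂ N]

/-- The decomposition of a module into its weight spaces. -/
def wtEquiv (ρM : Uq q →ₐ[ℂ] Module.End ℂ M) (h : DirectSum.IsInternal (wtSpace ρM)) :
    (DirectSum ℤ fun i => wtSpace ρM i) ≃ₗ[ℂ] M :=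
  LinearEquiv.ofBijective (DirectSum.coeLinearMap (wtSpace ρM)) (by exact h)

/-- The action of `q ^ (s H ⊗ H / 2)` on `M ⊗ N`, where `M` is the direct sum of its weight spaces
of weights `2 i`: it sends `v ⊗ w` to `v ⊗ K ^ (s i) w` for `v` of weight `2 i`. -/
def cartanPart (ρM : Uq q →ₐ[ℂ] Module.End ℂ M) (h : DirectSum.IsInternal (wtSpace ρM))
    (ρN : Uq q →ₐ[ℂ] Module.End ℂ N) (s : ℤ) : M ⊗[ℂ] N →ₗ[ℂ] M ⊗[ℂ] N :=
  TensorProduct.lift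
    ((DirectSum.toModule ℂ ℤ (N →ₗ[ℂ] M ⊗[ℂ] N) (fun i =>
        ((TensorProduct.mk ℂ M N).compl₂ (ρN ((Uq.Kunit q ^ (s * i) : (Uq q)ˣ) : Uq q))) ∘ₗ
          (wtSpace ρM i).subtype)) ∘ₗ
      (wtEquiv ρM h).symm.toLinearMap)

theorem cartanPart_tmul (ρM : Uq q →ₐ[ℂ] Module.End ℂ M) (h : DirectSum.IsInternal (wtSpace ρM))
    (ρN : Uq q →ₐ[ℂ] Module.End ℂ N) (s i : ℤ) (v : M) (hv : v ∈ wtSpace ρM i) (w : N) :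
    cartanPart ρM h ρN s (v ⊗ₜ w) = v ⊗ₜ ρN ((Uq.Kunit q ^ (s * i) : (Uq q)ˣ) : Uq q) w := by
  have h1 : (wtEquiv ρM h).symm v = DirectSum.lof ℂ ℤ (fun i => wtSpace ρM i) i ⟨v, hv⟩ := by
    rw [LinearEquiv.symm_apply_eq]
    exact (DirectSum.coeLinearMap_lof (wtSpace ρM) i ⟨v, hv⟩).symm
  simp [cartanPart, h1]

variable (q) in
/-- The `q`-number `[m]_q`. -/
def qNum (m : ℕ) : ℂ := ((q : ℂ) ^ m - ((q : ℂ) ^ m)⁻¹) / ((q : ℂ) - (q : ℂ)⁻¹)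

variable (q) in
/-- The `q`-factorial `[m]_q!`. -/
def qFact (m : ℕ) : ℂ := ∏ k ∈ Finset.range m, qNum q (k + 1)

variable (q) in
/-- The coefficient `q ^ (m (m - 1) / 2) (q - q⁻¹) ^ m / [m]_q!` of `E ^ m ⊗ F ^ m` in `R`. -/
def rCoeff (m : ℕ) : ℂ :=
  (q : ℂ) ^ (m * (m - 1) / 2) * ((q : ℂ) - (q : ℂ)⁻¹) ^ m / qFact q m

variable (q) in
/-- The coefficient `q ^ (-m (m - 1) / 2) (q⁻¹ - q) ^ m / [m]_q!` of `E ^ m ⊗ F ^ m` in `R⁻¹`. -/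
def rInvCoeff (m : ℕ) : ℂ :=
  ((q : ℂ) ^ (m * (m - 1) / 2))⁻¹ * ((q : ℂ)⁻¹ - (q : ℂ)) ^ m / qFact q m

/-- The action of the universal `R`-matrix
`R = q ^ (H ⊗ H / 2) ∑ₘ q ^ (m (m - 1) / 2) (q - q⁻¹) ^ m / [m]_q! E ^ m ⊗ F ^ m`
on `M ⊗ N`, where `M` is a module on which `E` is nilpotent and `K` is diagonalisable with
eigenvalues `q ^ (2 i)`. The terms with `m` at least the nilpotency class of `E` act by zero. -/
def rMatrix (ρM : Uq q →ₐ[ℂ] Module.End ℂ M) (h : DirectSum.IsInternal (wtSpace ρM))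
    (ρN : Uq q →ₐ[ℂ] Module.End ℂ N) : M ⊗[ℂ] N →ₗ[ℂ] M ⊗[ℂ] N :=
  cartanPart ρM h ρN 1 ∘ₗ
    ∑ m ∈ Finset.range (nilpotencyClass (ρM (Uq.E q))),
      rCoeff q m • TensorProduct.map (ρM (Uq.E q) ^ m) (ρN (Uq.F q) ^ m)

/-- The action of
`R₂₁ = q ^ (H ⊗ H / 2) ∑ₘ q ^ (m (m - 1) / 2) (q - q⁻¹) ^ m / [m]_q! F ^ m ⊗ E ^ m`
on `M ⊗ N`, where `M` is a module on which `F` is nilpotent and `K` is diagonalisable with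
eigenvalues `q ^ (2 i)`. -/
def rMatrix21 (ρM : Uq q →ₐ[ℂ] Module.End ℂ M) (h : DirectSum.IsInternal (wtSpace ρM))
    (ρN : Uq q →ₐ[ℂ] Module.End ℂ N) : M ⊗[ℂ] N →ₗ[ℂ] M ⊗[ℂ] N :=
  cartanPart ρM h ρN 1 ∘ₗ
    ∑ m ∈ Finset.range (nilpotencyClass (ρM (Uq.F q))),
      rCoeff q m • TensorProduct.map (ρM (Uq.F q) ^ m) (ρN (Uq.E q) ^ m)

/-- The action of
`R₂₁⁻¹ = (∑ₘ q ^ (-m (m - 1) / 2) (q⁻¹ - q) ^ m / [m]_q! F ^ m ⊗ E ^ m) q ^ (-H ⊗ H / 2)`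
on `M ⊗ N`, where `M` is a module on which `F` is nilpotent and `K` is diagonalisable with
eigenvalues `q ^ (2 i)`. -/
def rMatrix21Inv (ρM : Uq q →ₐ[ℂ] Module.End ℂ M) (h : DirectSum.IsInternal (wtSpace ρM))
    (ρN : Uq q →ₐ[ℂ] Module.End ℂ N) : M ⊗[ℂ] N →ₗ[ℂ] M ⊗[ℂ] N :=
  (∑ m ∈ Finset.range (nilpotencyClass (ρM (Uq.F q))),
      rInvCoeff q m • TensorProduct.map (ρM (Uq.F q) ^ m) (ρN (Uq.E q) ^ m)) ∘ₗ
    cartanPart ρM h ρN (-1)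

theorem sum_range_nilpotencyClass (a : ℕ → ℂ) {x : Module.End ℂ M} (y : Module.End ℂ N) {n : ℕ}
    (hx : x ^ n = 0) :
    ∑ m ∈ Finset.range (nilpotencyClass x), a m • TensorProduct.map (x ^ m) (y ^ m)
      = ∑ m ∈ Finset.range n, a m • TensorProduct.map (x ^ m) (y ^ m) := by
  refine Finset.sum_subset (Finset.range_mono (Nat.sInf_le hx)) (fun m _ hm => ?_)
  rw [Finset.mem_range, not_lt] at hm
  rw [pow_eq_zero_of_le hm (pow_nilpotencyClass ⟨n, hx⟩), TensorProduct.map_zero_left, smul_zero]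

end RMatrix

/-! ## Scalars -/
section scalars
variable (q : ℝ)

theorem sq_add_one_ne : (q : ℂ) ^ 2 + 1 ≠ 0 := by
  have : q ^ 2 + 1 ≠ 0 := by positivity
  exact_mod_cast this
theorem pow_four_add_one_ne : (q : ℂ) ^ 4 + 1 ≠ 0 := by
  have : q ^ 4 + 1 ≠ 0 := by positivity
  exact_mod_cast this

variable [hq : Fact (q ≠ 0)] [hq1 : Fact (q ^ 2 ≠ 1)]

theorem sq_sub_one_ne : (q : ℂ) ^ 2 - 1 ≠ 0 := by
  have : q ^ 2 - 1 ≠ 0 := sub_ne_zero.2 hq1.out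
  exact_mod_cast this
theorem sub_inv_ne : (q : ℂ) - (q : ℂ)⁻¹ ≠ 0 := by
  have h0 := Uq.q_ne q
  have h1 := sq_sub_one_ne q
  rw [show (q : ℂ) - (q : ℂ)⁻¹ = ((q : ℂ) ^ 2 - 1) / q by field_simp]
  exact div_ne_zero h1 h0

theorem qFact_zero : qFact q 0 = 1 := by simp [qFact]
theorem qFact_one : qFact q 1 = 1 := by
  simp [qFact, qNum, div_self (sub_inv_ne q)]
theorem qFact_two : qFact q 2 = (q : ℂ) + (q : ℂ)⁻¹ := by
  have h0 := Uq.q_ne q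
  have h1 := sq_sub_one_ne q
  simp only [qFact, qNum, Finset.prod_range_succ, Finset.prod_range_zero]
  norm_num
  field_simp
  ring
theorem rCoeff_zero : rCoeff q 0 = 1 := by simp [rCoeff, qFact_zero]
theorem rCoeff_one : rCoeff q 1 = (q : ℂ) - (q : ℂ)⁻¹ := by simp [rCoeff, qFact_one]
theorem rCoeff_two : rCoeff q 2
    = (q : ℂ) * ((q : ℂ) - (q : ℂ)⁻¹) ^ 2 / ((q : ℂ) + (q : ℂ)⁻¹) := by simp [rCoeff, qFact_two]
theorem rInvCoeff_zero : rInvCoeff q 0 = 1 := by simp [rInvCoeff, qFact_zero]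
theorem rInvCoeff_one : rInvCoeff q 1 = (q : ℂ)⁻¹ - (q : ℂ) := by simp [rInvCoeff, qFact_one]
theorem rInvCoeff_two : rInvCoeff q 2
    = (q : ℂ)⁻¹ * ((q : ℂ)⁻¹ - (q : ℂ)) ^ 2 / ((q : ℂ) + (q : ℂ)⁻¹) := by
  simp [rInvCoeff, qFact_two]

theorem zpow_two_mul_injective : Function.Injective (fun i : ℤ => (q : ℂ) ^ (2 * i)) := by
  intro i j hij
  have h2 : (q ^ 2) ^ i = (q ^ 2) ^ j := by
    have h3 : (q : ℂ) ^ (2 * i) = (q : ℂ) ^ (2 * j) := hij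
    have : q ^ (2 * i) = q ^ (2 * j) := by exact_mod_cast h3
    rw [zpow_mul, zpow_mul] at this
    exact_mod_cast this
  have hpos : 0 < q ^ 2 := by
    have := hq.out
    positivity
  exact zpow_right_injective₀ hpos hq1.out h2

theorem isInternal_wtSpace {M : Type*} [AddCommGroup M] [Module ℂ M]
    (ρ : Uq q →ₐ[ℂ] Module.End ℂ M) (h : ⨆ i, wtSpace ρ i = ⊤) :
    DirectSum.IsInternal (wtSpace ρ) :=
  DirectSum.isInternal_submodule_of_iSupIndep_of_iSup_eq_top
    ((Module.End.eigenspaces_iSupIndep (ρ (Uq.K q))).comp (zpow_two_mul_injective q)) h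

end scalars

/-! ## The quantised adjoint module and the normalised braiding -/

/-- The three-dimensional space underlying the module `V_{2π}`. -/
abbrev V : Type := Fin 3 → ℂ

/-- The basis vector of weight `2`. -/
def v₂ : V := Pi.single 0 1
/-- The basis vector of weight `0`. -/
def v₀ : V := Pi.single 1 1
/-- The basis vector of weight `-2`. -/
def vm₂ : V := Pi.single 2 1

/-- The linear map out of `V_{2π}` with prescribed values on `v₂`, `v₀`, `v₋₂`. -/
def vLin {A : Type*} [AddCommGroup A] [Module ℂ A] (a b d : A) : V →ₗ[ℂ] A :=
  (Pi.basisFun ℂ (Fin 3)).constr ℂ ![a, b, d]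

section vLin
variable {A : Type*} [AddCommGroup A] [Module ℂ A] (a b d : A)
@[simp] theorem vLin_v₂ : vLin a b d v₂ = a := by
  simp [vLin, v₂]
@[simp] theorem vLin_v₀ : vLin a b d v₀ = b := by
  simp [vLin, v₀]
@[simp] theorem vLin_vm₂ : vLin a b d vm₂ = d := by
  simp [vLin, vm₂]
theorem vLin_ext {f g : V →ₗ[ℂ] A} (h2 : f v₂ = g v₂) (h0 : f v₀ = g v₀) (hm : f vm₂ = g vm₂) :
    f = g := by
  refine (Pi.basisFun ℂ (Fin 3)).ext (fun i => ?_)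
  fin_cases i
  · simpa [v₂] using h2
  · simpa [v₀] using h0
  · simpa [vm₂] using hm
end vLin

section
variable (q : ℝ) [hq : Fact (q ≠ 0)] [hq1 : Fact (q ^ 2 ≠ 1)]

/-- The `U_q(sl_2)`-module structure on `V_{2π}`. -/
def repV : Uq q →ₐ[ℂ] Module.End ℂ V :=
  Uq.lift
    (vLin 0 (-((q : ℂ) + (q : ℂ)⁻¹) • v₂) v₀)
    (vLin (-v₀) (((q : ℂ) + (q : ℂ)⁻¹) • vm₂) 0)
    (vLin ((q : ℂ) ^ 2 • v₂) v₀ (((q : ℂ) ^ 2)⁻¹ • vm₂))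
    (vLin (((q : ℂ) ^ 2)⁻¹ • v₂) v₀ ((q : ℂ) ^ 2 • vm₂))
    (by have hq0 := Uq.q_ne q; apply vLin_ext <;> simp [smul_smul, hq0, mul_comm])
    (by have hq0 := Uq.q_ne q; apply vLin_ext <;> simp [smul_smul, hq0, mul_comm])
    (by have hq0 := Uq.q_ne q; apply vLin_ext <;> simp [smul_smul, hq0])
    (by have hq0 := Uq.q_ne q; apply vLin_ext <;> simp [smul_smul, hq0])
    (by
      have hq0 := Uq.q_ne q
      have h1 := sq_sub_one_ne q
      apply vLin_ext <;> simp <;> match_scalars <;> field_simp <;> ring)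

@[simp] theorem repV_E_v₂ : repV q (Uq.E q) v₂ = 0 := by
  simp [repV]
@[simp] theorem repV_E_v₀ : repV q (Uq.E q) v₀ = -((q : ℂ) + (q : ℂ)⁻¹) • v₂ := by
  simp [repV]
@[simp] theorem repV_E_vm₂ : repV q (Uq.E q) vm₂ = v₀ := by
  simp [repV]
@[simp] theorem repV_F_v₂ : repV q (Uq.F q) v₂ = -v₀ := by
  simp [repV]
@[simp] theorem repV_F_v₀ : repV q (Uq.F q) v₀ = ((q : ℂ) + (q : ℂ)⁻¹) • vm₂ := by
  simp [repV]
@[simp] theorem repV_F_vm₂ : repV q (Uq.F q) vm₂ = 0 := by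
  simp [repV]
@[simp] theorem repV_K_v₂ : repV q (Uq.K q) v₂ = (q : ℂ) ^ 2 • v₂ := by
  simp [repV]
@[simp] theorem repV_K_v₀ : repV q (Uq.K q) v₀ = v₀ := by
  simp [repV]
@[simp] theorem repV_K_vm₂ : repV q (Uq.K q) vm₂ = ((q : ℂ) ^ 2)⁻¹ • vm₂ := by
  simp [repV]
@[simp] theorem repV_Kinv_v₂ : repV q (Uq.Kinv q) v₂ = ((q : ℂ) ^ 2)⁻¹ • v₂ := by
  simp [repV]
@[simp] theorem repV_Kinv_v₀ : repV q (Uq.Kinv q) v₀ = v₀ := by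
  simp [repV]
@[simp] theorem repV_Kinv_vm₂ : repV q (Uq.Kinv q) vm₂ = (q : ℂ) ^ 2 • vm₂ := by
  simp [repV]

theorem v₂_mem : v₂ ∈ wtSpace (repV q) 1 := by
  simp [wtSpace, repV, zpow_ofNat]
theorem v₀_mem : v₀ ∈ wtSpace (repV q) 0 := by
  simp [wtSpace, repV]
theorem vm₂_mem : vm₂ ∈ wtSpace (repV q) (-1) := by
  simp [wtSpace, repV, zpow_neg, zpow_ofNat]

theorem repV_isInternal : DirectSum.IsInternal (wtSpace (repV q)) := by
  apply isInternal_wtSpace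
  rw [eq_top_iff]
  intro x _
  have hx : x = x 0 • v₂ + x 1 • v₀ + x 2 • vm₂ := by
    ext i
    fin_cases i <;> simp [v₂, v₀, vm₂]
  rw [hx]
  refine add_mem (add_mem ?_ ?_) ?_ <;> apply Submodule.smul_mem
  · exact Submodule.mem_iSup_of_mem 1 (v₂_mem q)
  · exact Submodule.mem_iSup_of_mem 0 (v₀_mem q)
  · exact Submodule.mem_iSup_of_mem (-1) (vm₂_mem q)

/-- The braiding `σ_R = τ ∘ R` of `V_{2π} ⊗ V_{2π}`. -/
def braidV : V ⊗[ℂ] V →ₗ[ℂ] V ⊗[ℂ] V :=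
  (TensorProduct.comm ℂ V V).toLinearMap ∘ₗ rMatrix (repV q) (repV_isInternal q) (repV q)

end

/-- The linear map out of `V_{2π} ⊗ V_{2π}` with prescribed values on the basis tensors, listed in
the order `v₂ ⊗ v₂, v₂ ⊗ v₀, v₂ ⊗ v₋₂, v₀ ⊗ v₂, …`. -/
def vvLin {A : Type*} [AddCommGroup A] [Module ℂ A] (a : Fin 3 → Fin 3 → A) : V ⊗[ℂ] V →ₗ[ℂ] A :=
  TensorProduct.lift (vLin (vLin (a 0 0) (a 0 1) (a 0 2)) (vLin (a 1 0) (a 1 1) (a 1 2))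
    (vLin (a 2 0) (a 2 1) (a 2 2)))

theorem vvLin_ext {A : Type*} [AddCommGroup A] [Module ℂ A] {f g : V ⊗[ℂ] V →ₗ[ℂ] A}
    (h22 : f (v₂ ⊗ₜ v₂) = g (v₂ ⊗ₜ v₂)) (h20 : f (v₂ ⊗ₜ v₀) = g (v₂ ⊗ₜ v₀))
    (h2m : f (v₂ ⊗ₜ vm₂) = g (v₂ ⊗ₜ vm₂)) (h02 : f (v₀ ⊗ₜ v₂) = g (v₀ ⊗ₜ v₂))
    (h00 : f (v₀ ⊗ₜ v₀) = g (v₀ ⊗ₜ v₀)) (h0m : f (v₀ ⊗ₜ vm₂) = g (v₀ ⊗ₜ vm₂))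
    (hm2 : f (vm₂ ⊗ₜ v₂) = g (vm₂ ⊗ₜ v₂)) (hm0 : f (vm₂ ⊗ₜ v₀) = g (vm₂ ⊗ₜ v₀))
    (hmm : f (vm₂ ⊗ₜ vm₂) = g (vm₂ ⊗ₜ vm₂)) : f = g := by
  apply TensorProduct.ext
  apply vLin_ext <;> apply vLin_ext <;> simpa

/-- The normalised braiding `σ̃ = τ ∘ R ∘ D⁻¹` of `V_{2π} ⊗ V_{2π}`, where `D` is the square root
of `R₂₁ R` with positive eigenvalues; see `normBraid_spec`. -/
def normBraid (q : ℝ) : V ⊗[ℂ] V →ₗ[ℂ] V ⊗[ℂ] V :=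
  vvLin
    ![![v₂ ⊗ₜ v₂,
        ((1 - (q : ℂ) ^ 4) / ((q : ℂ) ^ 4 + 1)) • (v₂ ⊗ₜ v₀)
          + (2 * (q : ℂ) ^ 2 / ((q : ℂ) ^ 4 + 1)) • (v₀ ⊗ₜ v₂),
        (2 * (q : ℂ) ^ 2 / ((q : ℂ) ^ 4 + 1)) • (vm₂ ⊗ₜ v₂)
          + (2 * ((q : ℂ) ^ 5 - (q : ℂ) ^ 3) / (((q : ℂ) ^ 2 + 1) * ((q : ℂ) ^ 4 + 1))) •
            (v₀ ⊗ₜ v₀)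
          + (((q : ℂ) ^ 2 - 1) ^ 2 / ((q : ℂ) ^ 4 + 1)) • (v₂ ⊗ₜ vm₂)],
      ![(((q : ℂ) ^ 4 - 1) / ((q : ℂ) ^ 4 + 1)) • (v₀ ⊗ₜ v₂)
          + (2 * (q : ℂ) ^ 2 / ((q : ℂ) ^ 4 + 1)) • (v₂ ⊗ₜ v₀),
        (2 * ((q : ℂ) ^ 2 - 1) * ((q : ℂ) ^ 2 + 1) / ((q : ℂ) * ((q : ℂ) ^ 4 + 1))) • (v₂ ⊗ₜ vm₂)
          - (((q : ℂ) ^ 4 - 4 * (q : ℂ) ^ 2 + 1) / ((q : ℂ) ^ 4 + 1)) • (v₀ ⊗ₜ v₀)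
          - (2 * ((q : ℂ) ^ 2 - 1) * ((q : ℂ) ^ 2 + 1) / ((q : ℂ) * ((q : ℂ) ^ 4 + 1))) •
            (vm₂ ⊗ₜ v₂),
        ((1 - (q : ℂ) ^ 4) / ((q : ℂ) ^ 4 + 1)) • (v₀ ⊗ₜ vm₂)
          + (2 * (q : ℂ) ^ 2 / ((q : ℂ) ^ 4 + 1)) • (vm₂ ⊗ₜ v₀)],
      ![(((q : ℂ) ^ 2 - 1) ^ 2 / ((q : ℂ) ^ 4 + 1)) • (vm₂ ⊗ₜ v₂)
          - (2 * ((q : ℂ) ^ 5 - (q : ℂ) ^ 3) / (((q : ℂ) ^ 2 + 1) * ((q : ℂ) ^ 4 + 1))) •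
            (v₀ ⊗ₜ v₀)
          + (2 * (q : ℂ) ^ 2 / ((q : ℂ) ^ 4 + 1)) • (v₂ ⊗ₜ vm₂),
        (((q : ℂ) ^ 4 - 1) / ((q : ℂ) ^ 4 + 1)) • (vm₂ ⊗ₜ v₀)
          + (2 * (q : ℂ) ^ 2 / ((q : ℂ) ^ 4 + 1)) • (v₀ ⊗ₜ vm₂),
        vm₂ ⊗ₜ vm₂]]

section
variable (q : ℝ) [hq : Fact (q ≠ 0)] [hq1 : Fact (q ^ 2 ≠ 1)]

theorem repV_E_pow : repV q (Uq.E q) ^ 3 = 0 := by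
  apply vLin_ext <;> simp [repV, pow_succ]

theorem braidV_tmul (x y : V) : braidV q (x ⊗ₜ y)
    = (TensorProduct.comm ℂ V V) (cartanPart (repV q) (repV_isInternal q) (repV q) 1
      (x ⊗ₜ y + rCoeff q 1 • (repV q (Uq.E q) x ⊗ₜ repV q (Uq.F q) y)
        + rCoeff q 2 • (repV q (Uq.E q) (repV q (Uq.E q) x) ⊗ₜ
            repV q (Uq.F q) (repV q (Uq.F q) y)))) := by
  rw [braidV, rMatrix, sum_range_nilpotencyClass _ _ (repV_E_pow q)]
  simp [Finset.sum_range_succ, pow_two, rCoeff_zero]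

theorem cartanV_v₂ (w : V) : cartanPart (repV q) (repV_isInternal q) (repV q) 1 (v₂ ⊗ₜ w)
    = v₂ ⊗ₜ repV q (Uq.K q) w := by
  rw [cartanPart_tmul _ _ _ _ 1 _ (v₂_mem q)]; simp [Uq.Kunit]
theorem cartanV_v₀ (w : V) : cartanPart (repV q) (repV_isInternal q) (repV q) 1 (v₀ ⊗ₜ w)
    = v₀ ⊗ₜ w := by
  rw [cartanPart_tmul _ _ _ _ 0 _ (v₀_mem q)]; simp
theorem cartanV_vm₂ (w : V) : cartanPart (repV q) (repV_isInternal q) (repV q) 1 (vm₂ ⊗ₜ w)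
    = vm₂ ⊗ₜ repV q (Uq.Kinv q) w := by
  rw [cartanPart_tmul _ _ _ _ (-1) _ (vm₂_mem q)]; simp [Uq.Kunit]

/-- The action of `σ_R` on the basis of `V_{2π} ⊗ V_{2π}`. -/
theorem braidV_eq : braidV q = vvLin
    ![![(q : ℂ) ^ 2 • (v₂ ⊗ₜ v₂), v₀ ⊗ₜ v₂, ((q : ℂ) ^ 2)⁻¹ • (vm₂ ⊗ₜ v₂)],
      ![v₂ ⊗ₜ v₀ + (((q : ℂ) ^ 4 - 1) / (q : ℂ) ^ 2) • (v₀ ⊗ₜ v₂),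
        v₀ ⊗ₜ v₀ - (((q : ℂ) ^ 2 - 1) * ((q : ℂ) ^ 2 + 1) ^ 2 / (q : ℂ) ^ 5) • (vm₂ ⊗ₜ v₂),
        vm₂ ⊗ₜ v₀],
      ![((q : ℂ) ^ 2)⁻¹ • (v₂ ⊗ₜ vm₂) + ((1 - (q : ℂ) ^ 2) / q) • (v₀ ⊗ₜ v₀)
          + (((q : ℂ) ^ 2 - 1) ^ 2 * ((q : ℂ) ^ 2 + 1) / (q : ℂ) ^ 4) • (vm₂ ⊗ₜ v₂),
        v₀ ⊗ₜ vm₂ + (((q : ℂ) ^ 4 - 1) / (q : ℂ) ^ 2) • (vm₂ ⊗ₜ v₀),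
        (q : ℂ) ^ 2 • (vm₂ ⊗ₜ vm₂)]] := by
  have h0 := Uq.q_ne q
  have h1 := sq_sub_one_ne q
  have h2 := sq_add_one_ne q
  apply vvLin_ext <;>
    simp [braidV_tmul, cartanV_v₂, cartanV_v₀, cartanV_vm₂, vvLin, rCoeff_one, rCoeff_two,
      TensorProduct.tmul_add, TensorProduct.add_tmul, TensorProduct.tmul_neg,
      TensorProduct.neg_tmul, TensorProduct.tmul_smul, ← TensorProduct.smul_tmul'] <;>
    match_scalars <;> field_simp <;> ring

theorem normBraid_normBraid : normBraid q * normBraid q = 1 := by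
  have h0 := Uq.q_ne q
  have h2 := sq_add_one_ne q
  have h4 := pow_four_add_one_ne q
  apply vvLin_ext <;> simp [normBraid, vvLin] <;> match_scalars <;> field_simp <;> ring

theorem braidV_normBraid_comm : braidV q * normBraid q = normBraid q * braidV q := by
  have h0 := Uq.q_ne q
  have h2 := sq_add_one_ne q
  have h4 := pow_four_add_one_ne q
  rw [braidV_eq]
  apply vvLin_ext <;> simp [normBraid, vvLin] <;> match_scalars <;> field_simp <;> ring

theorem braidV_on_neg : braidV q * normBraid q - braidV q = ((q : ℂ) ^ 2)⁻¹ • (1 - normBraid q) := by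
  have h0 := Uq.q_ne q
  have h2 := sq_add_one_ne q
  have h4 := pow_four_add_one_ne q
  rw [braidV_eq]
  apply vvLin_ext <;> simp [normBraid, vvLin] <;> match_scalars <;> field_simp <;> ring

theorem braidV_on_pos : (braidV q * braidV q - ((q : ℂ) ^ 2 + ((q : ℂ) ^ 4)⁻¹) • braidV q
    + ((q : ℂ) ^ 2)⁻¹ • 1) * (1 + normBraid q) = 0 := by
  have h0 := Uq.q_ne q
  have h2 := sq_add_one_ne q
  have h4 := pow_four_add_one_ne q
  rw [braidV_eq]
  apply vvLin_ext <;> simp [normBraid, vvLin] <;> match_scalars <;> field_simp <;> ring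

end

theorem spec_aux {R : Type*} [Ring R] [Algebra ℂ R] (B N : R) (x y z : ℂ) (hz : x * z = y)
    (hN : N * N = 1) (hc : B * N = N * B) (h1 : B * N - B = y • (1 - N))
    (h2 : (B * B - (x + z) • B + y • 1) * (1 + N) = 0) :
    B * N * (B * N) = B * B ∧ B = N * (B * N) ∧
      (B * N - x • 1) * (B * N - z • 1) * (B * N - y • 1) = 0 := by
  have hDD : B * N * (B * N) = B * B := by
    rw [hc, mul_assoc, ← mul_assoc B, hc, ← mul_assoc, ← mul_assoc, hN, one_mul]
  refine ⟨hDD, by rw [hc, ← mul_assoc, hN, one_mul], ?_⟩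
  have hBNN : B * N * N = B := by rw [mul_assoc, hN, mul_one]
  have h3 : (B * N - x • 1) * (B * N - z • 1) = B * B - (x + z) • (B * N) + y • 1 := by
    rw [mul_sub, sub_mul, sub_mul, hDD]
    simp only [smul_mul_assoc, mul_smul_comm, one_mul, mul_one, smul_smul]
    rw [mul_comm] at hz
    rw [hz]
    module
  have h4 : (B * N - y • 1) = (1 / 2 : ℂ) • ((1 + N) * (B - y • 1)) := by
    have h5 : B * N = B + y • (1 - N) := by rw [← h1]; abel
    simp only [add_mul, mul_sub, one_mul, mul_smul_comm, mul_one, ← hc]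
    rw [h5]
    module
  have h6 : (B * B - (x + z) • (B * N) + y • 1) * (1 + N) = 0 := by
    rw [← h2]
    simp only [add_mul, sub_mul, mul_add, smul_mul_assoc, one_mul, mul_one, hBNN]
    module
  rw [h3, h4, mul_smul_comm, ← mul_assoc, h6, zero_mul, smul_zero]

section
variable (q : ℝ) [hq : Fact (q ≠ 0)] [hq1 : Fact (q ^ 2 ≠ 1)]

/-- The characterisation of `σ̃`: one has `σ_R = σ̃ ∘ D`, where `D` is a diagonalisable operator with
positive eigenvalues and `D ^ 2 = σ_R ^ 2`, which is the action of `R₂₁ R`. -/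
theorem normBraid_spec : ∃ D : Module.End ℂ (V ⊗[ℂ] V),
    D * D = braidV q * braidV q ∧ braidV q = normBraid q * D ∧
      (D - (q : ℂ) ^ 2 • 1) * (D - ((q : ℂ) ^ 4)⁻¹ • 1) * (D - ((q : ℂ) ^ 2)⁻¹ • 1) = 0 := by
  have hN := normBraid_normBraid q
  have hc := braidV_normBraid_comm q
  have h1 := braidV_on_neg q
  have h2 := braidV_on_pos q
  have h0 := Uq.q_ne q
  set B : Module.End ℂ (V ⊗[ℂ] V) := braidV q
  set N : Module.End ℂ (V ⊗[ℂ] V) := normBraid q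
  refine ⟨B * N, ?_⟩
  exact spec_aux B N _ _ _ (by field_simp) hN hc h1 h2

end

/-! ## The `q`-deformed Clifford algebra -/

/-- The invariant bilinear form on `V_{2π}`: `⟨v₂, v₋₂⟩ = c`, `⟨v₀, v₀⟩ = q⁻³ (1 + q ^ 2) c`,
`⟨v₋₂, v₂⟩ = q⁻² c`, all other values being zero. -/
def form (q c : ℝ) : V ⊗[ℂ] V →ₗ[ℂ] ℂ :=
  vvLin ![![0, 0, (c : ℂ)], ![0, ((q : ℂ) ^ 3)⁻¹ * (1 + (q : ℂ) ^ 2) * c, 0],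
    ![(c : ℂ) * ((q : ℂ) ^ 2)⁻¹, 0, 0]]

/-- For a linear map `f : V_{2π} → A` to an algebra, the linear map `x ⊗ y ↦ f x * f y`. -/
def mulMap {A : Type*} [Ring A] [Algebra ℂ A] (f : V →ₗ[ℂ] A) : V ⊗[ℂ] V →ₗ[ℂ] A :=
  LinearMap.mul' ℂ A ∘ₗ TensorProduct.map f f

theorem mulMap_comp {A B : Type*} [Ring A] [Algebra ℂ A] [Ring B] [Algebra ℂ B] (g : A →ₐ[ℂ] B)
    (f : V →ₗ[ℂ] A) (t : V ⊗[ℂ] V) : mulMap (g.toLinearMap ∘ₗ f) t = g (mulMap f t) := by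
  have : mulMap (g.toLinearMap ∘ₗ f) = g.toLinearMap ∘ₗ mulMap f := by
    apply TensorProduct.ext'
    intro x y
    simp [mulMap]
  rw [this]
  rfl

/-- The relations `x ⊗ y + σ̃(x ⊗ y) = 2 ⟨x, y⟩` in the tensor algebra of `V_{2π}`. -/
inductive ClqRel (q c : ℝ) : TensorAlgebra ℂ V → TensorAlgebra ℂ V → Prop
  | rel (x y : V) : ClqRel q c
      (mulMap (TensorAlgebra.ι ℂ) (x ⊗ₜ y + normBraid q (x ⊗ₜ y)))
      (algebraMap ℂ (TensorAlgebra ℂ V) (2 * form q c (x ⊗ₜ y)))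

/-- The `q`-deformed Clifford algebra `Cl_q(sl_2)`. -/
def Clq (q c : ℝ) : Type := RingQuot (ClqRel q c)

instance (q c : ℝ) : Ring (Clq q c) := inferInstanceAs (Ring (RingQuot (ClqRel q c)))
instance (q c : ℝ) : Algebra ℂ (Clq q c) := inferInstanceAs (Algebra ℂ (RingQuot (ClqRel q c)))

/-- The multiplication table of `Cl_q(sl_2)`. -/
structure ClqTable (q c : ℝ) {A : Type*} [Ring A] [Algebra ℂ A] (a b d : A) : Prop where
  aa : a * a = 0
  dd : d * d = 0
  ba : b * a = -((q : ℂ) ^ 2)⁻¹ • (a * b)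
  db : d * b = -((q : ℂ) ^ 2)⁻¹ • (b * d)
  bb : b * b = ((1 - (q : ℂ) ^ 4) / (q : ℂ) ^ 3) • (a * d) + (((q : ℂ) ^ 2 + 1) / q * c) • 1
  da : d * a = (((q : ℂ) ^ 2 + 1) / (q : ℂ) ^ 2 * c) • 1 - a * d

section table
variable {q c : ℝ} [hq : Fact (q ≠ 0)] {A : Type*} [Ring A] [Algebra ℂ A]

theorem ClqTable.mulMap_eq {a b d : A} (h : ClqTable q c a b d) (x y : V) :
    mulMap (vLin a b d) (x ⊗ₜ y + normBraid q (x ⊗ₜ y))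
      = algebraMap ℂ A (2 * form q c (x ⊗ₜ y)) := by
  have key : mulMap (vLin a b d) ∘ₗ (LinearMap.id + normBraid q)
      = (2 : ℂ) • ((Algebra.linearMap ℂ A) ∘ₗ form q c) := by
    have h0 := Uq.q_ne q
    have h2 := sq_add_one_ne q
    have h4 := pow_four_add_one_ne q
    have halg : ∀ z : ℂ, algebraMap ℂ A z = z • 1 := Algebra.algebraMap_eq_smul_one
    apply vvLin_ext <;>
      simp [normBraid, form, vvLin, mulMap, h.aa, h.dd, h.ba, h.db, h.bb, h.da,
        halg, -Complex.coe_smul] <;>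
      match_scalars <;> field_simp <;> ring
  have := LinearMap.congr_fun key (x ⊗ₜ y)
  simp only [LinearMap.comp_apply, LinearMap.add_apply, LinearMap.id_apply, LinearMap.smul_apply,
    Algebra.linearMap_apply] at this
  rw [this, map_mul, Algebra.smul_def]

theorem ClqTable.of_rel {f : V →ₗ[ℂ] A}
    (h : ∀ x y : V, mulMap f (x ⊗ₜ y + normBraid q (x ⊗ₜ y))
      = algebraMap ℂ A (2 * form q c (x ⊗ₜ y))) : ClqTable q c (f v₂) (f v₀) (f vm₂) := by
  have h0 := Uq.q_ne q
  have h2 := sq_add_one_ne q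
  have h4 := pow_four_add_one_ne q
  have halg : ∀ z : ℂ, algebraMap ℂ A z = z • 1 := Algebra.algebraMap_eq_smul_one
  have r22 := h v₂ v₂
  have r20 := h v₂ v₀
  have r2m := h v₂ vm₂
  have r00 := h v₀ v₀
  have rm0 := h vm₂ v₀
  have rmm := h vm₂ vm₂
  clear h
  simp [normBraid, form, vvLin, mulMap, halg, -Complex.coe_smul] at r22 r20 r2m r00 rm0 rmm
  refine ⟨?_, ?_, ?_, ?_, ?_, ?_⟩
  · linear_combination (norm := skip) (1 / 2 : ℂ) • r22
    match_scalars; field_simp; ring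
  · linear_combination (norm := skip) (1 / 2 : ℂ) • rmm
    match_scalars; field_simp; ring
  · linear_combination (norm := skip) (((q : ℂ) ^ 4 + 1) / (2 * (q : ℂ) ^ 2)) • r20
    match_scalars <;> field_simp <;> ring
  · linear_combination (norm := skip) (((q : ℂ) ^ 4 + 1) / (2 * (q : ℂ) ^ 4)) • rm0
    match_scalars <;> field_simp <;> ring
  · linear_combination (norm := skip) (1 / 2 : ℂ) • r00
      + (((q : ℂ) ^ 4 - 1) / (2 * (q : ℂ) ^ 3)) • r2m
    match_scalars <;> field_simp <;> ring
  · linear_combination (norm := skip) (1 : ℂ) • r2m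
      - ((q : ℂ) * ((q : ℂ) ^ 2 - 1) / (2 * ((q : ℂ) ^ 2 + 1))) • r00
    match_scalars <;> field_simp <;> ring

end table

namespace Clq
variable (q c : ℝ)

/-- The quotient map from the tensor algebra. -/
def mk : TensorAlgebra ℂ V →ₐ[ℂ] Clq q c := RingQuot.mkAlgHom ℂ (ClqRel q c)

/-- The inclusion of `V_{2π}` as the space of generators. -/
def ι : V →ₗ[ℂ] Clq q c :=
  (mk q c).toLinearMap ∘ₗ TensorAlgebra.ι ℂ

/-- The generator `v₂`. -/
def g2 : Clq q c := ι q c v₂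
/-- The generator `v₀`. -/
def g0 : Clq q c := ι q c v₀
/-- The generator `v₋₂`. -/
def gm2 : Clq q c := ι q c vm₂

theorem ι_eq : ι q c = vLin (g2 q c) (g0 q c) (gm2 q c) := by
  apply vLin_ext <;> simp [g2, g0, gm2]

theorem table [Fact (q ≠ 0)] : ClqTable q c (g2 q c) (g0 q c) (gm2 q c) := by
  refine ClqTable.of_rel (f := ι q c) (fun x y => ?_)
  have h : mk q c _ = mk q c _ := RingQuot.mkAlgHom_rel ℂ (ClqRel.rel (q := q) (c := c) x y)
  rw [AlgHom.commutes] at h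
  rw [← h, ι, mulMap_comp]

variable {q c}

/-- The universal property of `Cl_q(sl_2)`. -/
def lift [Fact (q ≠ 0)] {A : Type*} [Ring A] [Algebra ℂ A] (a b d : A)
    (h : ClqTable q c a b d) : Clq q c →ₐ[ℂ] A :=
  RingQuot.liftAlgHom ℂ ⟨TensorAlgebra.lift ℂ (vLin a b d), by
    rintro _ _ ⟨x, y⟩
    rw [AlgHom.commutes, ← h.mulMap_eq, ← mulMap_comp]
    congr 2
    ext1
    simp⟩

section lift
variable [Fact (q ≠ 0)] {A : Type*} [Ring A] [Algebra ℂ A] (a b d : A) (h : ClqTable q c a b d)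

@[simp] theorem lift_g2 : lift a b d h (g2 q c) = a :=
  (RingQuot.liftAlgHom_mkAlgHom_apply ℂ _ _ _).trans (by simp)
@[simp] theorem lift_g0 : lift a b d h (g0 q c) = b :=
  (RingQuot.liftAlgHom_mkAlgHom_apply ℂ _ _ _).trans (by simp)
@[simp] theorem lift_gm2 : lift a b d h (gm2 q c) = d :=
  (RingQuot.liftAlgHom_mkAlgHom_apply ℂ _ _ _).trans (by simp)
end lift

/-- `Cl_q(sl_2)` is generated by `v₂`, `v₀`, `v₋₂`. -/
theorem induction {p : Clq q c → Prop} (hs : ∀ z : ℂ, p (algebraMap ℂ (Clq q c) z))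
    (h2 : p (g2 q c)) (h0 : p (g0 q c)) (hm : p (gm2 q c))
    (hadd : ∀ x y, p x → p y → p (x + y)) (hmul : ∀ x y, p x → p y → p (x * y))
    (x : Clq q c) : p x := by
  obtain ⟨t, rfl⟩ := RingQuot.mkAlgHom_surjective ℂ (ClqRel q c) x
  induction t using TensorAlgebra.induction with
  | algebraMap r =>
    rw [AlgHom.commutes]
    exact hs r
  | ι v =>
    have hv : RingQuot.mkAlgHom ℂ (ClqRel q c) (TensorAlgebra.ι ℂ v)
        = algebraMap ℂ (Clq q c) (v 0) * g2 q c + algebraMap ℂ (Clq q c) (v 1) * g0 q c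
          + algebraMap ℂ (Clq q c) (v 2) * gm2 q c := by
      have : v = v 0 • v₂ + v 1 • v₀ + v 2 • vm₂ := by
        ext i
        fin_cases i <;> simp [v₂, v₀, vm₂]
      change ι q c v = _
      conv_lhs => rw [this]
      simp only [map_add, map_smul, ← Algebra.smul_def]
      rfl
    rw [hv]
    exact hadd _ _ (hadd _ _ (hmul _ _ (hs _) h2) (hmul _ _ (hs _) h0)) (hmul _ _ (hs _) hm)
  | mul a b ha hb => rw [map_mul]; exact hmul _ _ ha hb
  | add a b ha hb => rw [map_add]; exact hadd _ _ ha hb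

end Clq

namespace Clq

theorem hom_ext {q c : ℝ} {A : Type*} [Ring A] [Algebra ℂ A] {f g : Clq q c →ₐ[ℂ] A}
    (h2 : f (g2 q c) = g (g2 q c)) (h0 : f (g0 q c) = g (g0 q c))
    (hm : f (gm2 q c) = g (gm2 q c)) : f = g := by
  refine AlgHom.ext (fun x => ?_)
  induction x using induction with
  | hs z => simp
  | h2 => exact h2
  | h0 => exact h0
  | hm => exact hm
  | hadd x y hx hy => rw [map_add, map_add, hx, hy]
  | hmul x y hx hy => rw [map_mul, map_mul, hx, hy]

section action
variable (q c : ℝ) [hq : Fact (q ≠ 0)]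

/-- The algebra endomorphism `v₂ ↦ t v₂`, `v₀ ↦ v₀`, `v₋₂ ↦ t⁻¹ v₋₂`. -/
def scale (t : ℂ) (ht : t ≠ 0) : Clq q c →ₐ[ℂ] Clq q c :=
  lift (t • g2 q c) (g0 q c) (t⁻¹ • gm2 q c) (by
    have h := table q c
    constructor <;> simp [h.aa, h.dd, h.ba, h.db, h.bb, h.da, smul_smul, ht, mul_comm])

/-- The action of `K`. -/
def actK : Clq q c →ₐ[ℂ] Clq q c := scale q c ((q : ℂ) ^ 2) (pow_ne_zero 2 (Uq.q_ne q))

/-- The action of `K⁻¹`. -/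
def actKinv : Clq q c →ₐ[ℂ] Clq q c :=
  scale q c (((q : ℂ) ^ 2)⁻¹) (inv_ne_zero (pow_ne_zero 2 (Uq.q_ne q)))

/-- The algebra map `x ↦ [[x, E x], [0, K x]]`, which encodes `E (x y) = (E x) (K y) + x (E y)`. -/
def homE : Clq q c →ₐ[ℂ] Matrix (Fin 2) (Fin 2) (Clq q c) :=
  lift !![g2 q c, 0; 0, (q : ℂ) ^ 2 • g2 q c]
    !![g0 q c, -((q : ℂ) + (q : ℂ)⁻¹) • g2 q c; 0, g0 q c]
    !![gm2 q c, g0 q c; 0, ((q : ℂ) ^ 2)⁻¹ • gm2 q c] (by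
    have h := table q c
    have h0 := Uq.q_ne q
    constructor <;> ext i j <;> fin_cases i <;> fin_cases j <;>
      simp [Matrix.mul_apply, Fin.sum_univ_two, h.aa, h.dd, h.ba, h.db, h.bb, h.da,
        -Complex.coe_smul] <;> match_scalars <;> field_simp <;> ring)

/-- The algebra map `x ↦ [[K⁻¹ x, F x], [0, x]]`, which encodes
`F (x y) = (F x) y + (K⁻¹ x) (F y)`. -/
def homF : Clq q c →ₐ[ℂ] Matrix (Fin 2) (Fin 2) (Clq q c) :=
  lift !![((q : ℂ) ^ 2)⁻¹ • g2 q c, -g0 q c; 0, g2 q c]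
    !![g0 q c, ((q : ℂ) + (q : ℂ)⁻¹) • gm2 q c; 0, g0 q c]
    !![(q : ℂ) ^ 2 • gm2 q c, 0; 0, gm2 q c] (by
    have h := table q c
    have h0 := Uq.q_ne q
    constructor <;> ext i j <;> fin_cases i <;> fin_cases j <;>
      simp [Matrix.mul_apply, Fin.sum_univ_two, h.aa, h.dd, h.ba, h.db, h.bb, h.da,
        -Complex.coe_smul] <;> match_scalars <;> field_simp <;> ring)

theorem homE_apply (x : Clq q c) :
    homE q c x 0 0 = x ∧ homE q c x 1 0 = 0 ∧ homE q c x 1 1 = actK q c x := by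
  induction x using induction with
  | hs z => simp [Matrix.algebraMap_matrix_apply]
  | h2 => simp [homE, actK, scale]
  | h0 => simp [homE, actK, scale]
  | hm => simp [homE, actK, scale]
  | hadd x y hx hy => simp [hx, hy]
  | hmul x y hx hy => simp [Matrix.mul_apply, Fin.sum_univ_two, hx, hy]

theorem homF_apply (x : Clq q c) :
    homF q c x 0 0 = actKinv q c x ∧ homF q c x 1 0 = 0 ∧ homF q c x 1 1 = x := by
  induction x using induction with
  | hs z => simp [Matrix.algebraMap_matrix_apply]
  | h2 => simp [homF, actKinv, scale]
  | h0 => simp [homF, actKinv, scale]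
  | hm => simp [homF, actKinv, scale]
  | hadd x y hx hy => simp [hx, hy]
  | hmul x y hx hy => simp [Matrix.mul_apply, Fin.sum_univ_two, hx, hy]

/-- The action of `E`. -/
def actE : Module.End ℂ (Clq q c) where
  toFun x := homE q c x 0 1
  map_add' x y := by simp
  map_smul' z x := by simp

/-- The action of `F`. -/
def actF : Module.End ℂ (Clq q c) where
  toFun x := homF q c x 0 1
  map_add' x y := by simp
  map_smul' z x := by simp

theorem actE_mul (x y : Clq q c) :
    actE q c (x * y) = actE q c x * actK q c y + x * actE q c y := by
  simp [actE, Matrix.mul_apply, Fin.sum_univ_two, homE_apply, add_comm]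

theorem actF_mul (x y : Clq q c) :
    actF q c (x * y) = actF q c x * y + actKinv q c x * actF q c y := by
  simp [actF, Matrix.mul_apply, Fin.sum_univ_two, homF_apply, add_comm]

@[simp] theorem actE_algebraMap (z : ℂ) : actE q c (algebraMap ℂ _ z) = 0 := by
  simp [actE, Matrix.algebraMap_matrix_apply]
@[simp] theorem actF_algebraMap (z : ℂ) : actF q c (algebraMap ℂ _ z) = 0 := by
  simp [actF, Matrix.algebraMap_matrix_apply]
@[simp] theorem actE_g2 : actE q c (g2 q c) = 0 := by simp [actE, homE]
@[simp] theorem actE_g0 : actE q c (g0 q c) = -((q : ℂ) + (q : ℂ)⁻¹) • g2 q c := by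
  simp [actE, homE]
@[simp] theorem actE_gm2 : actE q c (gm2 q c) = g0 q c := by simp [actE, homE]
@[simp] theorem actF_g2 : actF q c (g2 q c) = -g0 q c := by simp [actF, homF]
@[simp] theorem actF_g0 : actF q c (g0 q c) = ((q : ℂ) + (q : ℂ)⁻¹) • gm2 q c := by
  simp [actF, homF]
@[simp] theorem actF_gm2 : actF q c (gm2 q c) = 0 := by simp [actF, homF]
@[simp] theorem actK_g2 : actK q c (g2 q c) = (q : ℂ) ^ 2 • g2 q c := by simp [actK, scale]
@[simp] theorem actK_g0 : actK q c (g0 q c) = g0 q c := by simp [actK, scale]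
@[simp] theorem actK_gm2 : actK q c (gm2 q c) = ((q : ℂ) ^ 2)⁻¹ • gm2 q c := by
  simp [actK, scale]
@[simp] theorem actKinv_g2 : actKinv q c (g2 q c) = ((q : ℂ) ^ 2)⁻¹ • g2 q c := by
  simp [actKinv, scale]
@[simp] theorem actKinv_g0 : actKinv q c (g0 q c) = g0 q c := by simp [actKinv, scale]
@[simp] theorem actKinv_gm2 : actKinv q c (gm2 q c) = (q : ℂ) ^ 2 • gm2 q c := by
  simp [actKinv, scale]

theorem actK_actKinv (x : Clq q c) : actK q c (actKinv q c x) = x := by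
  have h0 := Uq.q_ne q
  have : (actK q c).comp (actKinv q c) = AlgHom.id ℂ _ := by
    apply hom_ext <;> simp [smul_smul, h0]
  exact AlgHom.congr_fun this x

theorem actKinv_actK (x : Clq q c) : actKinv q c (actK q c x) = x := by
  have h0 := Uq.q_ne q
  have : (actKinv q c).comp (actK q c) = AlgHom.id ℂ _ := by
    apply hom_ext <;> simp [smul_smul, h0]
  exact AlgHom.congr_fun this x

theorem actK_actE (x : Clq q c) : actK q c (actE q c x) = (q : ℂ) ^ 2 • actE q c (actK q c x) := by
  have h0 := Uq.q_ne q
  induction x using induction with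
  | hs z => simp
  | h2 => simp
  | h0 => simp [smul_smul, mul_comm, -Complex.coe_smul]
  | hm => simp [smul_smul, h0]
  | hadd x y hx hy => simp [hx, hy]
  | hmul x y hx hy => simp [actE_mul, hx, hy]

theorem actK_actF (x : Clq q c) :
    actK q c (actF q c x) = ((q : ℂ) ^ 2)⁻¹ • actF q c (actK q c x) := by
  have h0 := Uq.q_ne q
  induction x using induction with
  | hs z => simp
  | h2 => simp [smul_smul, h0]
  | h0 => simp [smul_smul, mul_comm, -Complex.coe_smul]
  | hm => simp
  | hadd x y hx hy => simp [hx, hy]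
  | hmul x y hx hy => simp [actF_mul, hx, hy, actK_actKinv, actKinv_actK]

theorem actE_actKinv (x : Clq q c) :
    actE q c (actKinv q c x) = (q : ℂ) ^ 2 • actKinv q c (actE q c x) := by
  have := congrArg (actKinv q c) (actK_actE q c (actKinv q c x))
  simpa [actK_actKinv, actKinv_actK] using this

theorem actE_actF [hq1 : Fact (q ^ 2 ≠ 1)] (x : Clq q c) :
    actE q c (actF q c x) - actF q c (actE q c x)
      = ((q : ℂ) - (q : ℂ)⁻¹)⁻¹ • (actK q c x - actKinv q c x) := by
  have h0 := Uq.q_ne q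
  have h1 := sq_sub_one_ne q
  induction x using induction with
  | hs z => simp
  | h2 => simp; match_scalars; field_simp; ring
  | h0 => simp; match_scalars; ring
  | hm => simp; match_scalars; field_simp; ring
  | hadd x y hx hy =>
    simp only [map_add]
    rw [add_sub_add_comm, hx, hy]
    module
  | hmul x y hx hy =>
    have e1 : actE q c (actF q c (x * y)) - actF q c (actE q c (x * y))
        = (actE q c (actF q c x) - actF q c (actE q c x)) * actK q c y
          + actKinv q c x * (actE q c (actF q c y) - actF q c (actE q c y)) := by
      simp only [actE_mul, actF_mul, map_add, actE_actKinv, actK_actF, mul_sub, sub_mul,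
        smul_mul_smul_comm]
      rw [mul_inv_cancel₀ (pow_ne_zero 2 h0), one_smul]
      abel
    rw [e1, hx, hy, map_mul, map_mul]
    simp only [smul_mul_assoc, mul_smul_comm, sub_mul, mul_sub]
    module

variable [hq1 : Fact (q ^ 2 ≠ 1)]

/-- The `U_q(sl_2)`-module structure on `Cl_q(sl_2)`: the one that extends the module structure of
`V_{2π}` and makes `Cl_q(sl_2)` a module algebra. -/
def rep : Uq q →ₐ[ℂ] Module.End ℂ (Clq q c) :=
  Uq.lift (actE q c) (actF q c) (actK q c).toLinearMap (actKinv q c).toLinearMap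
    (by ext x; exact actK_actE q c x)
    (by ext x; exact actK_actF q c x)
    (by ext x; exact actK_actKinv q c x)
    (by ext x; exact actKinv_actK q c x)
    (by ext x; exact actE_actF q c x)

@[simp] theorem rep_E : rep q c (Uq.E q) = actE q c := by simp [rep]
@[simp] theorem rep_F : rep q c (Uq.F q) = actF q c := by simp [rep]
@[simp] theorem rep_K : rep q c (Uq.K q) = (actK q c).toLinearMap := by simp [rep]
@[simp] theorem rep_Kinv : rep q c (Uq.Kinv q) = (actKinv q c).toLinearMap := by simp [rep]

theorem mem_wtSpace {i : ℤ} {x : Clq q c} :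
    x ∈ wtSpace (rep q c) i ↔ actK q c x = (q : ℂ) ^ (2 * i) • x := by
  simp [wtSpace]

theorem rep_isInternal : DirectSum.IsInternal (wtSpace (rep q c)) := by
  have h0 := Uq.q_ne q
  apply isInternal_wtSpace
  rw [Submodule.eq_top_iff']
  intro x
  induction x using induction with
  | hs z => exact Submodule.mem_iSup_of_mem 0 ((mem_wtSpace q c).2 (by simp))
  | h2 => exact Submodule.mem_iSup_of_mem 1 ((mem_wtSpace q c).2 (by simp [zpow_ofNat]))
  | h0 => exact Submodule.mem_iSup_of_mem 0 ((mem_wtSpace q c).2 (by simp))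
  | hm => exact Submodule.mem_iSup_of_mem (-1) ((mem_wtSpace q c).2
      (by simp [zpow_neg, zpow_ofNat]))
  | hadd x y hx hy => exact add_mem hx hy
  | hmul x y hx hy =>
    induction hx using Submodule.iSup_induction' with
    | zero => simp
    | add a b _ _ ha hb =>
      rw [add_mul]
      exact add_mem ha hb
    | mem i a ha =>
      induction hy using Submodule.iSup_induction' with
      | zero => simp
      | add a b _ _ ha hb =>
        rw [mul_add]
        exact add_mem ha hb
      | mem j b hb =>
        refine Submodule.mem_iSup_of_mem (i + j) ((mem_wtSpace q c).2 ?_)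
        rw [map_mul, (mem_wtSpace q c).1 ha, (mem_wtSpace q c).1 hb, smul_mul_smul_comm,
          ← zpow_add₀ h0, mul_add]

end action
end Clq

namespace Clq
section nilpotent
variable (q c : ℝ) [hq : Fact (q ≠ 0)]

/-- The span of the ordered monomials in the generators. -/
def monSpan : Submodule ℂ (Clq q c) :=
  Submodule.span ℂ {1, g2 q c, g0 q c, gm2 q c, g2 q c * g0 q c, g2 q c * gm2 q c,
    g0 q c * gm2 q c, g2 q c * (g0 q c * gm2 q c)}

theorem monSpan_eq_top : monSpan q c = ⊤ := by
  have h := table q c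
  have aa : ∀ x, g2 q c * (g2 q c * x) = 0 := fun x => by rw [← mul_assoc, h.aa, zero_mul]
  have ba : ∀ x, g0 q c * (g2 q c * x) = -((q : ℂ) ^ 2)⁻¹ • (g2 q c * (g0 q c * x)) := fun x => by
    rw [← mul_assoc, h.ba, smul_mul_assoc, mul_assoc]
  have db : ∀ x, gm2 q c * (g0 q c * x) = -((q : ℂ) ^ 2)⁻¹ • (g0 q c * (gm2 q c * x)) := fun x => by
    rw [← mul_assoc, h.db, smul_mul_assoc, mul_assoc]
  have bb : ∀ x, g0 q c * (g0 q c * x) = ((1 - (q : ℂ) ^ 4) / (q : ℂ) ^ 3) • (g2 q c * (gm2 q c * x))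
      + (((q : ℂ) ^ 2 + 1) / q * c) • x := fun x => by
    rw [← mul_assoc, h.bb, add_mul, smul_mul_assoc, smul_mul_assoc, mul_assoc, one_mul]
  have da : ∀ x, gm2 q c * (g2 q c * x) = (((q : ℂ) ^ 2 + 1) / (q : ℂ) ^ 2 * c) • x
      - g2 q c * (gm2 q c * x) := fun x => by
    rw [← mul_assoc, h.da, sub_mul, smul_mul_assoc, mul_assoc, one_mul]
  have m1 : (1 : Clq q c) ∈ monSpan q c := Submodule.subset_span (by simp)
  have m2 : g2 q c ∈ monSpan q c := Submodule.subset_span (by simp)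
  have m3 : g0 q c ∈ monSpan q c := Submodule.subset_span (by simp)
  have m4 : gm2 q c ∈ monSpan q c := Submodule.subset_span (by simp)
  have m5 : g2 q c * g0 q c ∈ monSpan q c := Submodule.subset_span (by simp)
  have m6 : g2 q c * gm2 q c ∈ monSpan q c := Submodule.subset_span (by simp)
  have m7 : g0 q c * gm2 q c ∈ monSpan q c := Submodule.subset_span (by simp)
  have m8 : g2 q c * (g0 q c * gm2 q c) ∈ monSpan q c := Submodule.subset_span (by simp)
  have key : ∀ x y : Clq q c, y ∈ monSpan q c → x * y ∈ monSpan q c := by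
    intro x
    induction x using induction with
    | hs z => intro y hy; rw [← Algebra.smul_def]; exact Submodule.smul_mem _ _ hy
    | hadd a b ha hb => intro y hy; rw [add_mul]; exact add_mem (ha y hy) (hb y hy)
    | hmul a b ha hb => intro y hy; rw [mul_assoc]; exact ha _ (hb y hy)
    | _ =>
      intro y hy
      induction hy using Submodule.span_induction with
      | zero => simp
      | add a b _ _ ha hb => rw [mul_add]; exact add_mem ha hb
      | smul r a _ ha => rw [mul_smul_comm]; exact Submodule.smul_mem _ _ ha
      | mem y hy =>
        simp only [Set.mem_insert_iff, Set.mem_singleton_iff] at hy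
        rcases hy with rfl | rfl | rfl | rfl | rfl | rfl | rfl | rfl <;>
          (try simp only [h.aa, h.dd, h.ba, h.db, h.bb, h.da, aa, ba, db, bb, da, mul_one, mul_add,
            mul_smul_comm, mul_zero, smul_zero, sub_zero, zero_add]) <;>
          repeat' first
            | assumption
            | exact zero_mem _
            | apply Submodule.smul_mem
            | apply add_mem
            | apply sub_mem
  exact eq_top_iff.2 fun x _ => by simpa using key x 1 m1

theorem actE_pow : actE q c ^ 3 = 0 := by
  ext x
  have hx : x ∈ monSpan q c := by rw [monSpan_eq_top]; trivial
  have h := table q c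
  have E1 : actE q c 1 = 0 := by simpa using actE_algebraMap q c 1
  simp only [pow_succ, pow_zero, one_mul, Module.End.mul_apply, LinearMap.zero_apply]
  induction hx using Submodule.span_induction with
  | zero => simp
  | add a b _ _ ha hb => simp only [map_add, ha, hb, add_zero]
  | smul r a _ ha => simp only [map_smul, ha, smul_zero]
  | mem y hy =>
    simp only [Set.mem_insert_iff, Set.mem_singleton_iff] at hy
    rcases hy with rfl | rfl | rfl | rfl | rfl | rfl | rfl | rfl <;>
      simp [actE_mul, E1, h.aa, h.bb, ← mul_assoc]

theorem actF_pow : actF q c ^ 3 = 0 := by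
  ext x
  have hx : x ∈ monSpan q c := by rw [monSpan_eq_top]; trivial
  have h := table q c
  have E1 : actF q c 1 = 0 := by simpa using actF_algebraMap q c 1
  simp only [pow_succ, pow_zero, one_mul, Module.End.mul_apply, LinearMap.zero_apply]
  induction hx using Submodule.span_induction with
  | zero => simp
  | add a b _ _ ha hb => simp only [map_add, ha, hb, add_zero]
  | smul r a _ ha => simp only [map_smul, ha, smul_zero]
  | mem y hy =>
    simp only [Set.mem_insert_iff, Set.mem_singleton_iff] at hy
    rcases hy with rfl | rfl | rfl | rfl | rfl | rfl | rfl | rfl <;>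
      simp [actF_mul, E1, h.dd, h.bb]

end nilpotent
end Clq

namespace Clq
section star
variable (q c : ℝ) [hq : Fact (q ≠ 0)]

/-- The star structure of `Cl_q(su_2)`, `v₂* = q ^ 2 v₋₂`, `v₀* = v₀`, `v₋₂* = q ^ (-2) v₂`, and of
`Cl_q(su_{1,1})`, `v₂* = -q ^ 2 v₋₂`, `v₀* = v₀`, `v₋₂* = -q ^ (-2) v₂`, as an algebra map to the
conjugate opposite algebra. -/
def starHom (s : RealForm) : Clq q c →ₐ[ℂ] ConjOp (Clq q c) :=
  lift (ConjOp.mk ((s.sgn * (q : ℂ) ^ 2) • gm2 q c)) (ConjOp.mk (g0 q c))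
    (ConjOp.mk ((s.sgn * ((q : ℂ) ^ 2)⁻¹) • g2 q c)) (by
      have h := table q c
      have h0 := Uq.q_ne q
      have hs := s.sgn_mul_sgn
      have h1 : s.sgn * ((q : ℂ) ^ 2)⁻¹ * (s.sgn * (q : ℂ) ^ 2) = 1 := by
        rw [mul_mul_mul_comm, hs, inv_mul_cancel₀ (pow_ne_zero 2 h0), one_mul]
      have h2 : s.sgn * (q : ℂ) ^ 2 * (s.sgn * ((q : ℂ) ^ 2)⁻¹) = 1 := by rw [mul_comm, h1]
      constructor <;> apply ConjOp.get_injective <;>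
        simp only [ConjOp.get_mul, ConjOp.get_mk, ConjOp.get_smul, ConjOp.get_add, ConjOp.get_sub,
          ConjOp.get_one, ConjOp.get_zero, smul_mul_assoc,
          mul_smul_comm, h.aa, h.dd, h.ba, h.db, h.bb, h.da, smul_zero, map_mul, map_div₀, map_add,
          map_sub, map_pow, map_inv₀, map_neg, map_one, Complex.conj_ofReal]
      · rw [smul_comm]
      · rw [smul_comm]
      · simp only [smul_smul, h2, one_smul]
      · simp only [smul_smul, h1, h2, one_smul])

/-- The star structure on `Cl_q(sl_2)` attached to a real form. -/
def star (s : RealForm) : Clq q c →ₛₗ[starRingEnd ℂ] Clq q c := ConjOp.toStar (starHom q c s)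

theorem star_mul (s : RealForm) (a b : Clq q c) :
    star q c s (a * b) = star q c s b * star q c s a := by
  simp [star, ConjOp.toStar]
theorem star_g2 (s : RealForm) : star q c s (g2 q c) = (s.sgn * (q : ℂ) ^ 2) • gm2 q c := by
  simp [star, ConjOp.toStar, starHom]
theorem star_g0 (s : RealForm) : star q c s (g0 q c) = g0 q c := by
  simp [star, ConjOp.toStar, starHom]
theorem star_gm2 (s : RealForm) :
    star q c s (gm2 q c) = (s.sgn * ((q : ℂ) ^ 2)⁻¹) • g2 q c := by
  simp [star, ConjOp.toStar, starHom]

end star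
end Clq

/-! ## The two braidings and the two Weil algebras -/

section Weil
variable (q c : ℝ) [hq : Fact (q ≠ 0)] [hq1 : Fact (q ^ 2 ≠ 1)]

/-- The action of `R` on `Cl_q(sl_2) ⊗ U_q(sl_2)`, with the adjoint action on `U_q(sl_2)`. -/
def rAct : Clq q c ⊗[ℂ] Uq q →ₗ[ℂ] Clq q c ⊗[ℂ] Uq q :=
  rMatrix (Clq.rep q c) (Clq.rep_isInternal q c) (Uq.ad q)

/-- The action of `R₂₁⁻¹` on `Cl_q(sl_2) ⊗ U_q(sl_2)`, with the adjoint action on `U_q(sl_2)`. -/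
def r21InvAct : Clq q c ⊗[ℂ] Uq q →ₗ[ℂ] Clq q c ⊗[ℂ] Uq q :=
  rMatrix21Inv (Clq.rep q c) (Clq.rep_isInternal q c) (Uq.ad q)

theorem cartanPart_comp {N : Type*} [AddCommGroup N] [Module ℂ N]
    (ρN : Uq q →ₐ[ℂ] Module.End ℂ N) (s t : ℤ) (hst : s + t = 0) :
    cartanPart (Clq.rep q c) (Clq.rep_isInternal q c) ρN s ∘ₗ
      cartanPart (Clq.rep q c) (Clq.rep_isInternal q c) ρN t = LinearMap.id := by
  apply TensorProduct.ext'
  intro x w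
  have hx : x ∈ ⨆ i, wtSpace (Clq.rep q c) i := by
    rw [(Clq.rep_isInternal q c).submodule_iSup_eq_top]
    trivial
  induction hx using Submodule.iSup_induction' with
  | zero => simp
  | add a b _ _ ha hb =>
    rw [TensorProduct.add_tmul, map_add, ha, hb, map_add]
  | mem i v hv =>
    rw [LinearMap.comp_apply, cartanPart_tmul _ _ _ _ i _ hv, cartanPart_tmul _ _ _ _ i _ hv,
      ← Module.End.mul_apply, ← map_mul, ← Units.val_mul, ← zpow_add, ← add_mul, hst]
    simp

theorem rCoeff_inverse {R : Type*} [Ring R] [Algebra ℂ R] (x : R) (hx : x ^ 3 = 0) :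
    (∑ m ∈ Finset.range 3, rCoeff q m • x ^ m) * (∑ m ∈ Finset.range 3, rInvCoeff q m • x ^ m) = 1
      ∧
    (∑ m ∈ Finset.range 3, rInvCoeff q m • x ^ m) * (∑ m ∈ Finset.range 3, rCoeff q m • x ^ m)
      = 1 := by
  have h0 := Uq.q_ne q
  have h2 := sq_add_one_ne q
  have e : rCoeff q 2 + rCoeff q 1 * rInvCoeff q 1 + rInvCoeff q 2 = 0 := by
    rw [rCoeff_one, rCoeff_two, rInvCoeff_one, rInvCoeff_two]
    field_simp
    ring
  have e1 : rCoeff q 1 + rInvCoeff q 1 = 0 := by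
    rw [rCoeff_one, rInvCoeff_one]
    ring
  have x3 : x * x ^ 2 = 0 := by rw [← pow_succ', hx]
  have x3' : x ^ 2 * x = 0 := by rw [← pow_succ, hx]
  have x4 : x ^ 2 * x ^ 2 = 0 := by rw [← pow_add, pow_succ, hx, zero_mul]
  simp only [Finset.sum_range_succ, Finset.sum_range_zero, zero_add, pow_zero, pow_one, rCoeff_zero,
    rInvCoeff_zero, one_smul, mul_add, add_mul, one_mul, mul_one, smul_mul_smul_comm, x3, x3', x4,
    smul_zero, add_zero, ← pow_two]
  constructor
  · calc _ = 1 + (rCoeff q 1 + rInvCoeff q 1) • x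
          + (rCoeff q 2 + rCoeff q 1 * rInvCoeff q 1 + rInvCoeff q 2) • x ^ 2 := by module
      _ = 1 := by rw [e, e1]; simp
  · calc _ = 1 + (rCoeff q 1 + rInvCoeff q 1) • x
          + (rCoeff q 2 + rCoeff q 1 * rInvCoeff q 1 + rInvCoeff q 2) • x ^ 2 := by module
      _ = 1 := by rw [e, e1]; simp

/-- The operator `r21InvAct` is the inverse of the action of `R₂₁`. -/
theorem r21InvAct_inverse :
    rMatrix21 (Clq.rep q c) (Clq.rep_isInternal q c) (Uq.ad q) ∘ₗ r21InvAct q c = LinearMap.id ∧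
    r21InvAct q c ∘ₗ rMatrix21 (Clq.rep q c) (Clq.rep_isInternal q c) (Uq.ad q) = LinearMap.id := by
  have hF : Clq.rep q c (Uq.F q) ^ 3 = 0 := by rw [Clq.rep_F, Clq.actF_pow]
  rw [r21InvAct, rMatrix21, rMatrix21Inv, sum_range_nilpotencyClass _ _ hF,
    sum_range_nilpotencyClass _ _ hF]
  set x : Module.End ℂ (Clq q c ⊗[ℂ] Uq q) :=
    TensorProduct.map (Clq.rep q c (Uq.F q)) (Uq.ad q (Uq.E q))
  have hx : ∀ m, TensorProduct.map (Clq.rep q c (Uq.F q) ^ m) (Uq.ad q (Uq.E q) ^ m) = x ^ m :=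
    fun m => (TensorProduct.map_pow _ _ m).symm
  have hx3 : x ^ 3 = 0 := by rw [← hx, hF, TensorProduct.map_zero_left]
  simp only [hx]
  obtain ⟨h1, h2⟩ := rCoeff_inverse q x hx3
  have c1 := cartanPart_comp q c (Uq.ad q) 1 (-1) (by norm_num)
  have c2 := cartanPart_comp q c (Uq.ad q) (-1) 1 (by norm_num)
  rw [Module.End.mul_eq_comp] at h1 h2
  constructor
  · rw [LinearMap.comp_assoc, ← LinearMap.comp_assoc (cartanPart _ _ _ (-1)), h1]
    exact c1
  · rw [LinearMap.comp_assoc, ← LinearMap.comp_assoc _ (cartanPart _ _ _ 1), c2,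
      LinearMap.id_comp, h2]
    rfl

/-- The braiding `σ_R = τ ∘ R` from `Cl_q(sl_2) ⊗ U_q(sl_2)` to `U_q(sl_2) ⊗ Cl_q(sl_2)`. -/
def braidMinus : Clq q c ⊗[ℂ] Uq q →ₗ[ℂ] Uq q ⊗[ℂ] Clq q c :=
  (TensorProduct.comm ℂ (Clq q c) (Uq q)).toLinearMap ∘ₗ rAct q c

/-- The braiding `τ ∘ R₂₁⁻¹` from `Cl_q(sl_2) ⊗ U_q(sl_2)` to `U_q(sl_2) ⊗ Cl_q(sl_2)`. -/
def braidPlus : Clq q c ⊗[ℂ] Uq q →ₗ[ℂ] Uq q ⊗[ℂ] Clq q c :=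
  (TensorProduct.comm ℂ (Clq q c) (Uq q)).toLinearMap ∘ₗ r21InvAct q c

/-- The multiplication `(m_A ⊗ m_B) ∘ (id ⊗ σ ⊗ id)` of a braided tensor product. -/
def braidedMul {A B : Type*} [Ring A] [Algebra ℂ A] [Ring B] [Algebra ℂ B]
    (σ : B ⊗[ℂ] A →ₗ[ℂ] A ⊗[ℂ] B) : (A ⊗[ℂ] B) ⊗[ℂ] (A ⊗[ℂ] B) →ₗ[ℂ] A ⊗[ℂ] B :=
  TensorProduct.map (LinearMap.mul' ℂ A) (LinearMap.mul' ℂ B) ∘ₗ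
    (TensorProduct.assoc ℂ A A (B ⊗[ℂ] B)).symm.toLinearMap ∘ₗ
    LinearMap.lTensor A (TensorProduct.assoc ℂ A B B).toLinearMap ∘ₗ
    LinearMap.lTensor A (LinearMap.rTensor B σ) ∘ₗ
    LinearMap.lTensor A (TensorProduct.assoc ℂ B A B).symm.toLinearMap ∘ₗ
    (TensorProduct.assoc ℂ A B (A ⊗[ℂ] B)).toLinearMap

theorem braidedMul_tmul {A B : Type*} [Ring A] [Algebra ℂ A] [Ring B] [Algebra ℂ B]
    (σ : B ⊗[ℂ] A →ₗ[ℂ] A ⊗[ℂ] B) (x y : A) (v w : B) :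
    braidedMul σ ((x ⊗ₜ v) ⊗ₜ (y ⊗ₜ w))
      = TensorProduct.map (LinearMap.mulLeft ℂ x) (LinearMap.mulRight ℂ w) (σ (v ⊗ₜ y)) := by
  simp only [braidedMul, LinearMap.comp_apply, LinearEquiv.coe_coe, TensorProduct.assoc_tmul,
    LinearMap.lTensor_tmul, TensorProduct.assoc_symm_tmul, LinearMap.rTensor_tmul]
  induction σ (v ⊗ₜ y) using TensorProduct.induction_on with
  | zero => simp
  | tmul a b => simp
  | add a b ha hb => simp only [TensorProduct.add_tmul, TensorProduct.tmul_add, map_add, ha, hb]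

/-- The Weil algebra `W_q⁻(sl_2)`, the braided tensor product of `U_q(sl_2)` and `Cl_q(sl_2)` with
respect to `R`. -/
def WMinus (q c : ℝ) : Type := Uq q ⊗[ℂ] Clq q c

/-- The Weil algebra `W_q⁺(sl_2)`, the braided tensor product of `U_q(sl_2)` and `Cl_q(sl_2)` with
respect to `R₂₁⁻¹`. -/
def WPlus (q c : ℝ) : Type := Uq q ⊗[ℂ] Clq q c

instance (q c : ℝ) : AddCommGroup (WMinus q c) :=
  inferInstanceAs (AddCommGroup (Uq q ⊗[ℂ] Clq q c))
instance (q c : ℝ) : Module ℂ (WMinus q c) := inferInstanceAs (Module ℂ (Uq q ⊗[ℂ] Clq q c))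
instance (q c : ℝ) : AddCommGroup (WPlus q c) :=
  inferInstanceAs (AddCommGroup (Uq q ⊗[ℂ] Clq q c))
instance (q c : ℝ) : Module ℂ (WPlus q c) := inferInstanceAs (Module ℂ (Uq q ⊗[ℂ] Clq q c))

/-- The element `a ⊗ b` of `W_q⁻(sl_2)`. -/
def WMinus.tmul {q c : ℝ} (a : Uq q) (b : Clq q c) : WMinus q c := a ⊗ₜ[ℂ] b
/-- The element `a ⊗ b` of `W_q⁺(sl_2)`. -/
def WPlus.tmul {q c : ℝ} (a : Uq q) (b : Clq q c) : WPlus q c := a ⊗ₜ[ℂ] b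

instance : Mul (WMinus q c) where
  mul x y := braidedMul (braidMinus q c) (TensorProduct.tmul ℂ (M := Uq q ⊗[ℂ] Clq q c)
    (N := Uq q ⊗[ℂ] Clq q c) x y)
instance (q c : ℝ) : One (WMinus q c) := ⟨WMinus.tmul 1 1⟩
instance : Mul (WPlus q c) where
  mul x y := braidedMul (braidPlus q c) (TensorProduct.tmul ℂ (M := Uq q ⊗[ℂ] Clq q c)
    (N := Uq q ⊗[ℂ] Clq q c) x y)
instance (q c : ℝ) : One (WPlus q c) := ⟨WPlus.tmul 1 1⟩

/-! ## The star maps -/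

/-- The antilinear map `a ⊗ b ↦ b* ⊗ a*`. -/
def starFlip (s : RealForm) : Uq q ⊗[ℂ] Clq q c →ₛₗ[starRingEnd ℂ] Clq q c ⊗[ℂ] Uq q :=
  (TensorProduct.map (Clq.star q c s) (Uq.star q s)).comp
    (TensorProduct.comm ℂ (Uq q) (Clq q c)).toLinearMap

/-- The antilinear map `W_q⁻ → W_q⁺`, `a ⊗ b ↦ τ (R₂₁⁻¹ (b* ⊗ a*))`. -/
def starMinus (s : RealForm) : WMinus q c →ₛₗ[starRingEnd ℂ] WPlus q c :=
  (((TensorProduct.comm ℂ (Clq q c) (Uq q)).toLinearMap ∘ₗ r21InvAct q c).comp (starFlip q c s) :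
    Uq q ⊗[ℂ] Clq q c →ₛₗ[starRingEnd ℂ] Uq q ⊗[ℂ] Clq q c)

/-- The antilinear map `W_q⁺ → W_q⁻`, `a ⊗ b ↦ τ (R (b* ⊗ a*))`. -/
def starPlus (s : RealForm) : WPlus q c →ₛₗ[starRingEnd ℂ] WMinus q c :=
  (((TensorProduct.comm ℂ (Clq q c) (Uq q)).toLinearMap ∘ₗ rAct q c).comp (starFlip q c s) :
    Uq q ⊗[ℂ] Clq q c →ₛₗ[starRingEnd ℂ] Uq q ⊗[ℂ] Clq q c)

/-! ## The cubic Dirac elements -/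

/-- `X = E`. -/
def xEl (q : ℝ) : Uq q := Uq.E q
/-- `Z = q⁻² E F - F E`. -/
def zEl (q : ℝ) : Uq q := ((q : ℂ) ^ 2)⁻¹ • (Uq.E q * Uq.F q) - Uq.F q * Uq.E q
/-- `Y = K F`. -/
def yEl (q : ℝ) : Uq q := Uq.K q * Uq.F q
/-- The quantum Casimir element `C = E F + (q⁻¹ K + q K⁻¹) / (q - q⁻¹) ^ 2`. -/
def casimir (q : ℝ) : Uq q :=
  Uq.E q * Uq.F q + (((q : ℂ) - (q : ℂ)⁻¹) ^ 2)⁻¹ • ((q : ℂ)⁻¹ • Uq.K q + (q : ℂ) • Uq.Kinv q)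

/-- The cubic element `γ = v₂ v₀ v₋₂ + c v₀` of `Cl_q(sl_2)`. -/
def gammaEl (q c : ℝ) : Clq q c :=
  Clq.g2 q c * Clq.g0 q c * Clq.gm2 q c + (c : ℂ) • Clq.g0 q c

/-- The cubic Dirac element `D_q⁻` of `W_q⁻(sl_2)`. -/
def dMinus (q c : ℝ) : WMinus q c :=
  (1 / (c : ℂ)) • (WMinus.tmul (xEl q) (Clq.gm2 q c)
      + ((q : ℂ) / (1 + (q : ℂ) ^ 2)) • WMinus.tmul (zEl q) (Clq.g0 q c)
      + ((q : ℂ) ^ 2)⁻¹ • WMinus.tmul (yEl q) (Clq.g2 q c))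
    - (((q : ℂ) ^ 2 - 1) ^ 2 / (2 * (q : ℂ) * ((q : ℂ) ^ 2 + 1) * (c : ℂ) ^ 2)) •
      WMinus.tmul (casimir q) (gammaEl q c)

/-- The cubic Dirac element `D_q⁺` of `W_q⁺(sl_2)`. -/
def dPlus (q c : ℝ) : WPlus q c :=
  ((q : ℂ) ^ 4 / (c : ℂ)) • (WPlus.tmul (xEl q) (Clq.gm2 q c)
      + ((q : ℂ) / (1 + (q : ℂ) ^ 2)) • WPlus.tmul (zEl q) (Clq.g0 q c)
      + ((q : ℂ) ^ 2)⁻¹ • WPlus.tmul (yEl q) (Clq.g2 q c))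
    - (((q : ℂ) ^ 2 - 1) ^ 2 / (2 * (q : ℂ) * ((q : ℂ) ^ 2 + 1) * (c : ℂ) ^ 2)) •
      WPlus.tmul (casimir q) (gammaEl q c)

end Weil

end QWeil
end

/-! Under the adjoint action, `X`, `Z`, `Y` span a copy of `V_{2π}`, with `X`, `Z`, `Y` in the roles
of `v₂`, `v₀`, `v₋₂` (`Uq.ad_E_yEl`, `Uq.ad_E_zEl`, `Uq.ad_F_xEl`, `Uq.ad_F_zEl`). The two star
structures agree under this identification (`Uq.star_xEl`, `Uq.star_yEl`, `Uq.star_zEl`). The linear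
part of the Dirac element, `X ⊗ v₋₂ + q/(1+q²) Z ⊗ v₀ + q⁻² Y ⊗ v₂`, is the invariant vector of
`V_{2π} ⊗ V_{2π}`. Its coefficients are real, and `a ⊗ b ↦ b* ⊗ a*` sends it to the same invariant
`v₂ ⊗ Y + q/(1+q²) v₀ ⊗ Z + q⁻² v₋₂ ⊗ X`, now with the Clifford leg in front. The sign of the real
form enters squared and disappears.

A braiding acts on the invariant line by a scalar: `τ ∘ R` by `q⁻⁴`, and `τ ∘ R₂₁⁻¹`, which inverts
the braiding, by `q⁴`. This is the factor `q⁴` by which the linear parts of `D_q⁻` and `D_q⁺`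
differ. The scalars are not derived from representation theory; they come out of the explicit action
of `R` and `R₂₁⁻¹` on the three basis tensors, which needs only the terms `m ≤ 2` because `E` and
`F` have cube zero on the Clifford algebra.

The cubic part `C ⊗ γ` has the same coefficient in both elements. Both factors are self-adjoint
(`Uq.star_casimir`, `Clq.star_gammaEl`). The adjoint actions of `E` and `F` kill `C`, so only the
Cartan factor of the `R`-matrix survives, and it is trivial since `γ` has weight zero
(`rAct_gammaEl_casimir`, `r21InvAct_gammaEl_casimir`). -/

namespace QWeil
namespace Uq
variable (q : ℝ) [hq : Fact (q ≠ 0)]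

/-! ### Commutation rules for rewriting in `U_q(sl_2)` -/

theorem ad_Kinv (b : Uq q) : ad q (Kinv q) b = Kinv q * b * K q := by
  simp [ad, coprod, antipode, mul_assoc]

theorem E_mul_K : E q * K q = ((q : ℂ) ^ 2)⁻¹ • (K q * E q) := by
  rw [K_mul_E, smul_smul, inv_mul_cancel₀ (pow_ne_zero 2 (q_ne q)), one_smul]

theorem F_mul_K : F q * K q = (q : ℂ) ^ 2 • (K q * F q) := by
  rw [K_mul_F, smul_smul, mul_inv_cancel₀ (pow_ne_zero 2 (q_ne q)), one_smul]

/-- Together with the rules moving `K` and `K⁻¹` to the left, this orders every monomial as a power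
of `K`, then `F`, then `E`. Identities in `U_q(sl_2)` then reduce to comparing scalars. -/
theorem E_mul_F : E q * F q = F q * E q + ((q : ℂ) - (q : ℂ)⁻¹)⁻¹ • (K q - Kinv q) := by
  rw [← E_F_comm]; abel

/-- The versions with a trailing factor `x` let the same rewriting reach the interior of
right-associated products. -/
theorem K_mul_Kinv_mul (x : Uq q) : K q * (Kinv q * x) = x := by
  rw [← mul_assoc, K_mul_Kinv, one_mul]

theorem Kinv_mul_K_mul (x : Uq q) : Kinv q * (K q * x) = x := by
  rw [← mul_assoc, Kinv_mul_K, one_mul]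

theorem E_mul_K_mul (x : Uq q) : E q * (K q * x) = ((q : ℂ) ^ 2)⁻¹ • (K q * (E q * x)) := by
  rw [← mul_assoc, E_mul_K, smul_mul_assoc, mul_assoc]

theorem F_mul_K_mul (x : Uq q) : F q * (K q * x) = (q : ℂ) ^ 2 • (K q * (F q * x)) := by
  rw [← mul_assoc, F_mul_K, smul_mul_assoc, mul_assoc]

theorem E_mul_Kinv_mul (x : Uq q) : E q * (Kinv q * x) = (q : ℂ) ^ 2 • (Kinv q * (E q * x)) := by
  rw [← mul_assoc, E_mul_Kinv, smul_mul_assoc, mul_assoc]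

theorem F_mul_Kinv_mul (x : Uq q) :
    F q * (Kinv q * x) = ((q : ℂ) ^ 2)⁻¹ • (Kinv q * (F q * x)) := by
  rw [← mul_assoc, F_mul_Kinv, smul_mul_assoc, mul_assoc]

theorem E_mul_F_mul (x : Uq q) : E q * (F q * x)
    = F q * (E q * x) + ((q : ℂ) - (q : ℂ)⁻¹)⁻¹ • (K q * x - Kinv q * x) := by
  rw [← mul_assoc, E_mul_F, add_mul, smul_mul_assoc, sub_mul, mul_assoc]

/-! ### Adjoint action: the copy of `V_{2π}` spanned by `X`, `Z`, `Y`, and the invariance of the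
Casimir element -/

variable [hq1 : Fact (q ^ 2 ≠ 1)]

theorem ad_K_xEl : ad q (K q) (xEl q) = (q : ℂ) ^ 2 • xEl q := by
  simp [ad_K, xEl, K_mul_E, mul_assoc, K_mul_Kinv]

theorem ad_Kinv_xEl : ad q (Kinv q) (xEl q) = ((q : ℂ) ^ 2)⁻¹ • xEl q := by
  simp [ad_Kinv, xEl, E_mul_K, mul_assoc, Kinv_mul_K_mul]

theorem ad_K_yEl : ad q (K q) (yEl q) = ((q : ℂ) ^ 2)⁻¹ • yEl q := by
  simp [ad_K, yEl, F_mul_Kinv, mul_assoc, K_mul_Kinv_mul]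

theorem ad_Kinv_yEl : ad q (Kinv q) (yEl q) = (q : ℂ) ^ 2 • yEl q := by
  simp [ad_Kinv, yEl, F_mul_K, Kinv_mul_K_mul, -Complex.coe_smul]

theorem ad_E_xEl : ad q (E q) (xEl q) = 0 := by
  simp [ad_E, xEl, mul_assoc]

/-- Only the position of `K` has to be changed here: both orders `E F` and `F E` already occur in
`Z`, so the relation for `E F - F E` plays no part. -/
theorem ad_E_yEl : ad q (E q) (yEl q) = zEl q := by
  have h0 := q_ne q
  simp only [ad_E, yEl, zEl, mul_assoc, E_mul_Kinv, E_mul_K_mul, F_mul_Kinv, F_mul_Kinv_mul,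
    E_mul_Kinv_mul, mul_smul_comm, smul_mul_assoc, K_mul_Kinv_mul, smul_smul]
  match_scalars <;> field_simp

/-- Here the products contain `E F E`, `E E F` and `F E E`, so the relation for `E F - F E` is
needed. The terms in `K E` and `K⁻¹ E` that it produces combine with the reordered ones to a
multiple of `E` alone. -/
theorem ad_E_zEl : ad q (E q) (zEl q) = -((q : ℂ) + (q : ℂ)⁻¹) • xEl q := by
  have h0 := q_ne q
  have h1 := sq_sub_one_ne q
  simp only [ad_E, xEl, zEl, mul_assoc, E_mul_F_mul, E_mul_F, E_mul_Kinv, F_mul_Kinv_mul,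
    E_mul_Kinv_mul, K_mul_Kinv_mul, E_mul_K, mul_smul_comm, smul_mul_assoc, mul_sub, sub_mul,
    mul_add, add_mul, smul_smul, smul_sub, smul_add]
  match_scalars <;> field_simp <;> ring

theorem ad_F_xEl : ad q (F q) (xEl q) = -zEl q := by
  have h0 := q_ne q
  simp only [ad_F, xEl, zEl, mul_assoc, E_mul_K_mul, mul_smul_comm, Kinv_mul_K_mul]
  match_scalars <;> field_simp

theorem ad_F_yEl : ad q (F q) (yEl q) = 0 := by
  simp [ad_F, yEl, Kinv_mul_K_mul]

theorem ad_F_zEl : ad q (F q) (zEl q) = ((q : ℂ) + (q : ℂ)⁻¹) • yEl q := by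
  have h0 := q_ne q
  have h1 := sq_sub_one_ne q
  simp only [ad_F, yEl, zEl, mul_assoc, E_mul_F, E_mul_K_mul, F_mul_K_mul, F_mul_Kinv,
    Kinv_mul_K_mul, F_mul_K, K_mul_Kinv, Kinv_mul_K, mul_one, one_mul, mul_smul_comm,
    smul_mul_assoc, mul_sub, sub_mul, mul_add, add_mul, smul_smul, smul_sub, smul_add]
  match_scalars <;> field_simp <;> ring

/-- This expresses that `C` commutes with `E`, since `ad_E b = (E b - b E) K⁻¹`. The terms in `K`
and `K⁻¹` in `C` are chosen to compensate the commutator of `E` with `E F`. -/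
theorem ad_E_casimir : ad q (E q) (casimir q) = 0 := by
  have h0 := q_ne q
  have h1 := sq_sub_one_ne q
  simp only [ad_E, casimir, mul_assoc, E_mul_F_mul, E_mul_F, E_mul_Kinv, F_mul_Kinv_mul,
    E_mul_Kinv_mul, K_mul_Kinv_mul, E_mul_K, mul_smul_comm, smul_mul_assoc, mul_sub, sub_mul,
    mul_add, add_mul, smul_smul, smul_sub, smul_add]
  match_scalars <;> field_simp <;> ring

/-- For `b` commuting with `K`, `ad_F b = F b - K⁻¹ b K F` is the commutator `F b - b F`, which
vanishes for the central element `C`. -/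
theorem ad_F_casimir : ad q (F q) (casimir q) = 0 := by
  have h0 := q_ne q
  have h1 := sq_sub_one_ne q
  simp only [ad_F, casimir, mul_assoc, E_mul_F, E_mul_K_mul, F_mul_K_mul, F_mul_Kinv,
    Kinv_mul_K_mul, F_mul_K, K_mul_Kinv, Kinv_mul_K, mul_one, one_mul, mul_smul_comm,
    smul_mul_assoc, mul_sub, sub_mul, mul_add, add_mul, smul_smul, smul_sub, smul_add]
  match_scalars <;> field_simp <;> ring

/-! ### The star structure on `X`, `Z`, `Y` and `C` -/

variable (s : RealForm)

theorem star_Kinv : star q s (Kinv q) = Kinv q := by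
  simp [star, ConjOp.toStar, starHom]

/-- The factor is the one in `v₂* = ε q² v₋₂`. The match between the two star structures is what
makes the scalars cancel in `b* ⊗ a*`. -/
theorem star_xEl : star q s (xEl q) = (s.sgn * (q : ℂ) ^ 2) • yEl q := by
  rw [xEl, star_E, F_mul_K, smul_smul, yEl]

theorem star_yEl : star q s (yEl q) = (s.sgn * ((q : ℂ) ^ 2)⁻¹) • xEl q := by
  rw [yEl, star_mul, star_F, star_K, smul_mul_assoc, mul_assoc, E_mul_K, mul_smul_comm,
    Kinv_mul_K_mul, smul_smul, xEl]

/-- The sign occurs once in `E*` and once in `F*`, so self-adjointness holds for both real forms.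
With the same fact for `F E`, it makes `Z` and `C` self-adjoint, their coefficients being real. -/
theorem star_E_mul_F : star q s (E q * F q) = E q * F q := by
  rw [star_mul, star_E, star_F, smul_mul_smul_comm, s.sgn_mul_sgn, one_smul, F_mul_K,
    mul_smul_comm, mul_assoc, E_mul_K_mul, mul_smul_comm, Kinv_mul_K_mul, smul_smul,
    mul_inv_cancel₀ (pow_ne_zero 2 (q_ne q)), one_smul]

theorem star_F_mul_E : star q s (F q * E q) = F q * E q := by
  rw [star_mul, star_E, star_F, smul_mul_smul_comm, s.sgn_mul_sgn, one_smul, mul_assoc,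
    K_mul_Kinv_mul]

theorem star_zEl : star q s (zEl q) = zEl q := by
  simp only [zEl, map_sub, map_smulₛₗ, star_E_mul_F, star_F_mul_E, map_inv₀, map_pow,
    Complex.conj_ofReal]

theorem star_casimir : star q s (casimir q) = casimir q := by
  simp only [casimir, map_add, map_smulₛₗ, star_E_mul_F, star_K, star_Kinv, map_inv₀, map_pow,
    map_sub, Complex.conj_ofReal]

end Uq

/-! ### The Clifford side: self-adjointness of `γ` and weights -/

section Weil
variable (q c : ℝ) [hq : Fact (q ≠ 0)] [hq1 : Fact (q ^ 2 ≠ 1)]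

/-- Reversing `v₂ v₀ v₋₂` and exchanging `v₂` with `v₋₂` restores the original order, and the two
scalars are inverse to each other. No Clifford relation is needed. -/
theorem Clq.star_gammaEl (s : RealForm) : Clq.star q c s (gammaEl q c) = gammaEl q c := by
  have h0 := pow_ne_zero 2 (Uq.q_ne q)
  have hs : s.sgn * ((q : ℂ) ^ 2)⁻¹ * (s.sgn * (q : ℂ) ^ 2) = 1 := by
    rw [mul_mul_mul_comm, s.sgn_mul_sgn, inv_mul_cancel₀ h0, one_mul]
  simp only [gammaEl, map_add, map_smulₛₗ, Clq.star_mul, Clq.star_g2, Clq.star_g0, Clq.star_gm2,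
    smul_mul_assoc, mul_smul_comm, smul_smul, mul_assoc, hs, mul_comm (s.sgn * (q : ℂ) ^ 2),
    one_smul, Complex.conj_ofReal]

theorem Clq.g2_mem_wtSpace : Clq.g2 q c ∈ wtSpace (Clq.rep q c) 1 :=
  (Clq.mem_wtSpace q c).2 (by simp [zpow_ofNat])

theorem Clq.g0_mem_wtSpace : Clq.g0 q c ∈ wtSpace (Clq.rep q c) 0 :=
  (Clq.mem_wtSpace q c).2 (by simp)

theorem Clq.gm2_mem_wtSpace : Clq.gm2 q c ∈ wtSpace (Clq.rep q c) (-1) :=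
  (Clq.mem_wtSpace q c).2 (by simp [zpow_neg, zpow_ofNat])

theorem Clq.gammaEl_mem_wtSpace : gammaEl q c ∈ wtSpace (Clq.rep q c) 0 :=
  (Clq.mem_wtSpace q c).2 (by
    have h0 := Uq.q_ne q
    simp [gammaEl, smul_smul, h0, -Complex.coe_smul])

/-! ### The operators `R` and `R₂₁⁻¹` on the tensors occurring in the Dirac elements -/

theorem rAct_tmul (x : Clq q c) (a : Uq q) : rAct q c (x ⊗ₜ a)
    = cartanPart (Clq.rep q c) (Clq.rep_isInternal q c) (Uq.ad q) 1
      (x ⊗ₜ a + rCoeff q 1 • (Clq.actE q c x ⊗ₜ Uq.ad q (Uq.F q) a)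
        + rCoeff q 2 • (Clq.actE q c (Clq.actE q c x) ⊗ₜ
            Uq.ad q (Uq.F q) (Uq.ad q (Uq.F q) a))) := by
  -- The bound 3 comes from `E ^ 3 = 0` on the Clifford algebra; the exact nilpotency class need not
  -- be known.
  rw [rAct, rMatrix, sum_range_nilpotencyClass _ _ (n := 3) (by rw [Clq.rep_E, Clq.actE_pow])]
  simp [Finset.sum_range_succ, pow_two, rCoeff_zero]

/-- In `R₂₁⁻¹` the Cartan factor acts first, so a single weight, that of `x`, determines it: `b` is
`K ^ (-i)` applied to `a`. In `R` it acts last, on terms whose first legs have different weights,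
and therefore stays unevaluated in `rAct_tmul`. -/
theorem r21InvAct_tmul {i : ℤ} {x : Clq q c} (hx : x ∈ wtSpace (Clq.rep q c) i) {a b : Uq q}
    (hb : Uq.ad q ((Uq.Kunit q ^ (-i) : (Uq q)ˣ) : Uq q) a = b) : r21InvAct q c (x ⊗ₜ a)
    = x ⊗ₜ b + rInvCoeff q 1 • (Clq.actF q c x ⊗ₜ Uq.ad q (Uq.E q) b)
      + rInvCoeff q 2 • (Clq.actF q c (Clq.actF q c x) ⊗ₜ
          Uq.ad q (Uq.E q) (Uq.ad q (Uq.E q) b)) := by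
  rw [r21InvAct, rMatrix21Inv,
    sum_range_nilpotencyClass _ _ (n := 3) (by rw [Clq.rep_F, Clq.actF_pow]), LinearMap.comp_apply,
    cartanPart_tmul _ _ _ _ i _ hx, neg_one_mul, hb]
  simp [Finset.sum_range_succ, pow_two, rInvCoeff_zero]

theorem cartanPart_g2_tmul (a : Uq q) :
    cartanPart (Clq.rep q c) (Clq.rep_isInternal q c) (Uq.ad q) 1 (Clq.g2 q c ⊗ₜ a)
      = Clq.g2 q c ⊗ₜ Uq.ad q (Uq.K q) a := by
  rw [cartanPart_tmul _ _ _ _ 1 _ (Clq.g2_mem_wtSpace q c)]; simp [Uq.Kunit]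

theorem cartanPart_g0_tmul (a : Uq q) :
    cartanPart (Clq.rep q c) (Clq.rep_isInternal q c) (Uq.ad q) 1 (Clq.g0 q c ⊗ₜ a)
      = Clq.g0 q c ⊗ₜ a := by
  rw [cartanPart_tmul _ _ _ _ 0 _ (Clq.g0_mem_wtSpace q c)]; simp

theorem cartanPart_gm2_tmul (a : Uq q) :
    cartanPart (Clq.rep q c) (Clq.rep_isInternal q c) (Uq.ad q) 1 (Clq.gm2 q c ⊗ₜ a)
      = Clq.gm2 q c ⊗ₜ Uq.ad q (Uq.Kinv q) a := by
  rw [cartanPart_tmul _ _ _ _ (-1) _ (Clq.gm2_mem_wtSpace q c)]; simp [Uq.Kunit]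

/-- `R` raises the Clifford leg and lowers the other one. Since `v₂` is a highest weight vector,
only the Cartan factor remains; the tensors `v₀ ⊗ Z` and `v₋₂ ⊗ X` below acquire one and two further
terms. -/
theorem rAct_g2_yEl : rAct q c (Clq.g2 q c ⊗ₜ yEl q)
    = ((q : ℂ) ^ 2)⁻¹ • (Clq.g2 q c ⊗ₜ yEl q) := by
  simp [rAct_tmul, cartanPart_g2_tmul, Uq.ad_K_yEl]

theorem rAct_g0_zEl : rAct q c (Clq.g0 q c ⊗ₜ zEl q) = Clq.g0 q c ⊗ₜ zEl q
    - (((q : ℂ) - (q : ℂ)⁻¹) * ((q : ℂ) + (q : ℂ)⁻¹) ^ 2 * ((q : ℂ) ^ 2)⁻¹) •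
      (Clq.g2 q c ⊗ₜ yEl q) := by
  simp only [rAct_tmul, Clq.actE_g0, Clq.actE_g2, map_smul, map_add, Uq.ad_F_zEl, Uq.ad_F_yEl,
    cartanPart_g2_tmul, cartanPart_g0_tmul, Uq.ad_K_yEl, rCoeff_one, smul_zero,
    TensorProduct.tmul_smul, TensorProduct.zero_tmul, ← TensorProduct.smul_tmul']
  simp only [map_zero]
  module

/-- The last coefficient is the `m = 2` term: `E² v₋₂` and `ad_F² X` each contribute `-(q + q⁻¹)`,
one such factor cancels against `[2]_q!`, and the Cartan factor gives `q⁻²` on `Y`. -/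
theorem rAct_gm2_xEl : rAct q c (Clq.gm2 q c ⊗ₜ xEl q)
    = ((q : ℂ) ^ 2)⁻¹ • (Clq.gm2 q c ⊗ₜ xEl q)
      - ((q : ℂ) - (q : ℂ)⁻¹) • (Clq.g0 q c ⊗ₜ zEl q)
      + (((q : ℂ) - (q : ℂ)⁻¹) ^ 2 * ((q : ℂ) + (q : ℂ)⁻¹) * (q : ℂ)⁻¹) •
      (Clq.g2 q c ⊗ₜ yEl q) := by
  have h0 := Uq.q_ne q
  have h2 := sq_add_one_ne q
  simp only [rAct_tmul, Clq.actE_g0, Clq.actE_gm2, map_smul, map_add, map_neg, Uq.ad_F_zEl,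
    Uq.ad_F_xEl, cartanPart_g2_tmul, cartanPart_g0_tmul, cartanPart_gm2_tmul, Uq.ad_K_yEl,
    Uq.ad_Kinv_xEl, rCoeff_one, rCoeff_two, TensorProduct.tmul_neg,
    TensorProduct.tmul_smul, ← TensorProduct.smul_tmul']
  match_scalars <;> field_simp

theorem rAct_gammaEl_casimir : rAct q c (gammaEl q c ⊗ₜ casimir q)
    = gammaEl q c ⊗ₜ casimir q := by
  rw [rAct_tmul, Uq.ad_F_casimir]
  simp only [map_zero, TensorProduct.tmul_zero, smul_zero, add_zero]
  rw [cartanPart_tmul _ _ _ _ 0 _ (Clq.gammaEl_mem_wtSpace q c)]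
  simp

/-- Now the Clifford leg is lowered and the other one raised, so the triangular pattern is reversed:
`v₂ ⊗ Y` has three terms and `v₋₂ ⊗ X` only one. -/
theorem r21InvAct_g2_yEl : r21InvAct q c (Clq.g2 q c ⊗ₜ yEl q)
    = (q : ℂ) ^ 2 • (Clq.g2 q c ⊗ₜ yEl q)
      + ((q : ℂ) ^ 2 * ((q : ℂ) - (q : ℂ)⁻¹)) • (Clq.g0 q c ⊗ₜ zEl q)
      + ((q : ℂ) * ((q : ℂ) - (q : ℂ)⁻¹) ^ 2 * ((q : ℂ) + (q : ℂ)⁻¹)) •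
        (Clq.gm2 q c ⊗ₜ xEl q) := by
  have h0 := Uq.q_ne q
  have h2 := sq_add_one_ne q
  rw [r21InvAct_tmul q c (Clq.g2_mem_wtSpace q c) (b := (q : ℂ) ^ 2 • yEl q)
    -- `v₂` has weight index 1, so the Cartan factor of `R₂₁⁻¹` acts on `Y` as `K⁻¹`.
    (by rw [zpow_neg_one]; exact Uq.ad_Kinv_yEl q)]
  simp only [Clq.actF_g2, Clq.actF_g0, map_smul, map_neg, Uq.ad_E_yEl, Uq.ad_E_zEl, rInvCoeff_one,
    rInvCoeff_two, TensorProduct.neg_tmul, TensorProduct.tmul_smul, ← TensorProduct.smul_tmul']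
  match_scalars <;> field_simp <;> ring

theorem r21InvAct_g0_zEl : r21InvAct q c (Clq.g0 q c ⊗ₜ zEl q) = Clq.g0 q c ⊗ₜ zEl q
    + (((q : ℂ) - (q : ℂ)⁻¹) * ((q : ℂ) + (q : ℂ)⁻¹) ^ 2) • (Clq.gm2 q c ⊗ₜ xEl q) := by
  rw [r21InvAct_tmul q c (Clq.g0_mem_wtSpace q c) (b := zEl q) (by simp)]
  simp only [Clq.actF_g0, Clq.actF_gm2, map_smul, Uq.ad_E_zEl, Uq.ad_E_xEl, rInvCoeff_one,
    TensorProduct.tmul_smul, ← TensorProduct.smul_tmul', TensorProduct.zero_tmul, smul_zero]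
  module

theorem r21InvAct_gm2_xEl : r21InvAct q c (Clq.gm2 q c ⊗ₜ xEl q)
    = (q : ℂ) ^ 2 • (Clq.gm2 q c ⊗ₜ xEl q) := by
  rw [r21InvAct_tmul q c (Clq.gm2_mem_wtSpace q c) (b := (q : ℂ) ^ 2 • xEl q)
    (by rw [neg_neg, zpow_one]; exact Uq.ad_K_xEl q)]
  simp [-Complex.coe_smul, TensorProduct.tmul_smul]

theorem r21InvAct_gammaEl_casimir : r21InvAct q c (gammaEl q c ⊗ₜ casimir q)
    = gammaEl q c ⊗ₜ casimir q := by
  rw [r21InvAct_tmul q c (Clq.gammaEl_mem_wtSpace q c) (b := casimir q) (by simp),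
    Uq.ad_E_casimir]
  simp

/-- Definitional, since `WMinus` and `WPlus` have the same underlying tensor product and differ only
in their multiplication. -/
theorem starMinus_tmul (s : RealForm) (a : Uq q) (b : Clq q c) :
    starMinus q c s (WMinus.tmul a b)
      = TensorProduct.comm ℂ _ _ (r21InvAct q c (Clq.star q c s b ⊗ₜ Uq.star q s a)) := rfl

theorem starPlus_tmul (s : RealForm) (a : Uq q) (b : Clq q c) :
    starPlus q c s (WPlus.tmul a b)
      = TensorProduct.comm ℂ _ _ (rAct q c (Clq.star q c s b ⊗ₜ Uq.star q s a)) := rfl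

end Weil
end QWeil

/-! ### The exchange of the two Dirac elements -/

open QWeil

/-- For real `q ≠ 0, ±1`, real `c ≠ 0` and each of the two real forms `U_q(su_2)`, `U_q(su_{1,1})`,
the star maps between the two Weil algebras exchange the two cubic Dirac elements. -/
theorem mainTheorem4 (q c : ℝ) [Fact (q ≠ 0)] [Fact (q ^ 2 ≠ 1)] (hc : c ≠ 0)
    (s : QWeil.RealForm) :
    QWeil.starMinus q c s (QWeil.dMinus q c) = QWeil.dPlus q c ∧
      QWeil.starPlus q c s (QWeil.dPlus q c) = QWeil.dMinus q c := by
  have h0 := Uq.q_ne q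
  have hc0 : (c : ℂ) ≠ 0 := by exact_mod_cast hc
  have h2 : 1 + (q : ℂ) ^ 2 ≠ 0 := by rw [add_comm]; exact sq_add_one_ne q
  -- The scalars of `v₋₂*` and `X*` cancel, and in `h1'` those of `v₂*` and `Y*`; this removes the
  -- dependence on the real form.
  have h1 : s.sgn * ((q : ℂ) ^ 2)⁻¹ * (s.sgn * (q : ℂ) ^ 2) = 1 := by
    rw [mul_mul_mul_comm, s.sgn_mul_sgn, inv_mul_cancel₀ (pow_ne_zero 2 h0), one_mul]
  have h1' : s.sgn * (q : ℂ) ^ 2 * (s.sgn * ((q : ℂ) ^ 2)⁻¹) = 1 := by rw [mul_comm, h1]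
  constructor
  · have hX : starMinus q c s (WMinus.tmul (xEl q) (Clq.gm2 q c))
        = (q : ℂ) ^ 2 • WPlus.tmul (yEl q) (Clq.g2 q c)
          + ((q : ℂ) ^ 2 * ((q : ℂ) - (q : ℂ)⁻¹)) • WPlus.tmul (zEl q) (Clq.g0 q c)
          + ((q : ℂ) * ((q : ℂ) - (q : ℂ)⁻¹) ^ 2 * ((q : ℂ) + (q : ℂ)⁻¹)) •
            WPlus.tmul (xEl q) (Clq.gm2 q c) := by
      rw [starMinus_tmul, Clq.star_gm2, Uq.star_xEl, TensorProduct.smul_tmul_smul, h1, one_smul,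
        r21InvAct_g2_yEl]
      simp only [map_add, map_smul, TensorProduct.comm_tmul]
      rfl
    have hZ : starMinus q c s (WMinus.tmul (zEl q) (Clq.g0 q c))
        = WPlus.tmul (zEl q) (Clq.g0 q c)
          + (((q : ℂ) - (q : ℂ)⁻¹) * ((q : ℂ) + (q : ℂ)⁻¹) ^ 2) •
            WPlus.tmul (xEl q) (Clq.gm2 q c) := by
      rw [starMinus_tmul, Clq.star_g0, Uq.star_zEl, r21InvAct_g0_zEl]
      simp only [map_add, map_smul, TensorProduct.comm_tmul]
      rfl
    have hY : starMinus q c s (WMinus.tmul (yEl q) (Clq.g2 q c))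
        = (q : ℂ) ^ 2 • WPlus.tmul (xEl q) (Clq.gm2 q c) := by
      rw [starMinus_tmul, Clq.star_g2, Uq.star_yEl, TensorProduct.smul_tmul_smul, h1', one_smul,
        r21InvAct_gm2_xEl]
      simp only [map_smul, TensorProduct.comm_tmul]
      rfl
    have hC : starMinus q c s (WMinus.tmul (casimir q) (gammaEl q c))
        = WPlus.tmul (casimir q) (gammaEl q c) := by
      rw [starMinus_tmul, Clq.star_gammaEl, Uq.star_casimir, r21InvAct_gammaEl_casimir]
      rfl
    simp only [dMinus, dPlus, map_sub, map_add, map_smulₛₗ, hX, hY, hZ, hC, map_div₀, map_mul,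
      map_pow, map_inv₀, map_one, map_ofNat, Complex.conj_ofReal]
    -- The eigenvalue `q⁴` on the invariant vector, coefficient by coefficient. For `X ⊗ v₋₂` it
    -- reads `q (q - q⁻¹)² (q + q⁻¹) + q/(1+q²) (q - q⁻¹) (q + q⁻¹)² + 1 = q⁴`, and for `Z ⊗ v₀` it
    -- reads `q² (q - q⁻¹) + q/(1+q²) = q⁴ · q/(1+q²)`.
    match_scalars <;> field_simp <;> ring
  · have hX : starPlus q c s (WPlus.tmul (xEl q) (Clq.gm2 q c))
        = ((q : ℂ) ^ 2)⁻¹ • WMinus.tmul (yEl q) (Clq.g2 q c) := by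
      rw [starPlus_tmul, Clq.star_gm2, Uq.star_xEl, TensorProduct.smul_tmul_smul, h1, one_smul,
        rAct_g2_yEl]
      simp only [map_smul, TensorProduct.comm_tmul]
      rfl
    have hZ : starPlus q c s (WPlus.tmul (zEl q) (Clq.g0 q c))
        = WMinus.tmul (zEl q) (Clq.g0 q c)
          - (((q : ℂ) - (q : ℂ)⁻¹) * ((q : ℂ) + (q : ℂ)⁻¹) ^ 2 * ((q : ℂ) ^ 2)⁻¹) •
            WMinus.tmul (yEl q) (Clq.g2 q c) := by
      rw [starPlus_tmul, Clq.star_g0, Uq.star_zEl, rAct_g0_zEl]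
      simp only [map_sub, map_smul, TensorProduct.comm_tmul]
      rfl
    have hY : starPlus q c s (WPlus.tmul (yEl q) (Clq.g2 q c))
        = ((q : ℂ) ^ 2)⁻¹ • WMinus.tmul (xEl q) (Clq.gm2 q c)
          - ((q : ℂ) - (q : ℂ)⁻¹) • WMinus.tmul (zEl q) (Clq.g0 q c)
          + (((q : ℂ) - (q : ℂ)⁻¹) ^ 2 * ((q : ℂ) + (q : ℂ)⁻¹) * (q : ℂ)⁻¹) •
            WMinus.tmul (yEl q) (Clq.g2 q c) := by
      rw [starPlus_tmul, Clq.star_g2, Uq.star_yEl, TensorProduct.smul_tmul_smul, h1', one_smul,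
        rAct_gm2_xEl]
      simp only [map_add, map_sub, map_smul, TensorProduct.comm_tmul]
      rfl
    have hC : starPlus q c s (WPlus.tmul (casimir q) (gammaEl q c))
        = WMinus.tmul (casimir q) (gammaEl q c) := by
      rw [starPlus_tmul, Clq.star_gammaEl, Uq.star_casimir, rAct_gammaEl_casimir]
      rfl
    simp only [dMinus, dPlus, map_sub, map_add, map_smulₛₗ, hX, hY, hZ, hC, map_div₀, map_mul,
      map_pow, map_inv₀, map_one, map_ofNat, Complex.conj_ofReal]
    -- The eigenvalue is now `q⁻⁴`, which cancels the prefactor `q⁴` of `D_q⁺`.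
    match_scalars <;> field_simp <;> ring
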